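/- **Sparse approximation on graphs.** Let $G=(V,E)$ be a connected simple graph (finite or infinite) all of whose vertices have finite degree; the degrees need not be bounded. Let $L_2(G)$ be the Hilbert space of square-summable functions $f:V\to\mathbb C$, and let $L$ be the Laplacian $Lf(v)=\sum_{u\sim v}(f(v)-f(u))$ on its maximal domain $\{f\in L_2(G): Lf\in L_2(G)\}$; $\mathrm{dom}(L^k)$ is the set of $f\in L_2(G)$ with $Lf,\dots,L^kf\in L_2(G)$. There is a spectral Fourier transform of $L$, that is, a unitary operator $\mathcal F$ from $L_2(G)$ onto some $L^2(X,\mu)$ that carries $L$, with its domain, to multiplication by a measurable function $\lambda: X\to[0,\infty)$. Fix any such $\mathcal F$ and put $$e^{itL}f=\mathcal F^{-1}\big(e^{it\lambda}\mathcal Ff\big),\qquad PW_\omega(L)=\{f\in L_2(G):\ \mathcal Ff=0 \text{ a.e. on } \{\lambda>\omega\}\},$$ $$\Delta^m_sf=\sum_{j=0}^m(-1)^{m+j}\binom mj e^{ijsL}f,\qquad \Omega_m(f,s)=\sup_{|\tau|\le s}\|\Delta^m_\tau f\|.$$ For an even integer $n\ge m+2$ let $$h(t)=a\Big(\frac{\sin(t/n)}{t}\Big)^n,\qquad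 a=\Big(\int_{-\infty}^\infty\Big(\frac{\sin(t/n)}{t}\Big)^n\,dt\Big)^{-1},$$ $$\mathcal P_h^{\omega,m}f=\int_{-\infty}^\infty h(t)\big\{(-1)^{m-1}\Delta^m_{t/\omega}f+f\big\}\,dt .$$ Let $S\subset V$, let $bS$ be the set of vertices outside $S$ that are adjacent to a vertex of $S$, and let $K_0\ge1$ be an integer. Assume that $S\cup bS=V$, that every vertex of $bS$ is adjacent to at least $K_0$ vertices of $S$, and that $0<\omega<K_0/4$. Then there are functions $\Theta_u\in PW_\omega(L)$, $u\in S$, such that $$g=\sum_{u\in S}g(u)\Theta_u\qquad\text{for all } g\in PW_\omega(L),$$ with unconditional convergence in $L_2(G)$. For every such family $(\Theta_u)_{u\in S}$, all $m\ge 0$ and $n$ as above and every $f\in L_2(G)$, the integral defining $\mathcal P_h^{\omega,m}f$ converges absolutely and lies in $PW_\omega(L)$, the two series below converge unconditionally, and, with $f_\omega$ the orthogonal projection of $f$ onto $PW_\omega(L)$, $$\Big\|f-\sum_{u\in S}f_\omega(u)\Theta_u\Big\|\le\Big\|f-\sum_{u\in S}\big(\mathcal P_h^{\omega,m}f\big)(u)\Theta_u\Big\|.$$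 For every $0\le k\le m$, if moreover $f\in\mathrm{dom}(L^k)$ (which is automatic for $k=0$, and for all $k$ if the degrees are bounded), then $$\Big\|f-\sum_{u\in S}\big(\mathcal P_h^{\omega,m}f\big)(u)\Theta_u\Big\|\le\frac{C_{k,m}}{\omega^{k}}\,\Omega_{m-k}\big(L^kf,1/\omega\big).$$ The constant $C_{k,m}>0$ depends only on $k$, $m$ and $n$ (that is, on $k$, $m$ and $h$), not on $G$, $S$, $K_0$, $\omega$, $(\Theta_u)$ or $f$. -/

import Mathlib

open MeasureTheory

universe u w

noncomputable section

namespace GraphSampling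

/-- The Hilbert space `L₂(G)` of square-summable complex functions on the vertex set `V`. -/
abbrev L2 (V : Type u) : Type u := lp (fun _ : V => ℂ) 2

section Laplacian

variable {V : Type u} (G : SimpleGraph V) [G.LocallyFinite]

/-- The formal combinatorial Laplacian `(L f)(v) = ∑_{u ∼ v} (f v - f u)`, on all functions. -/
def lap (f : V → ℂ) : V → ℂ := fun v => ∑ u ∈ G.neighborFinset v, (f v - f u)

/-- The domain of `L ^ k`. The operator `L` acts on its maximal domain
`{f ∈ L₂(G) : L f ∈ L₂(G)}`, so that `f ∈ dom (L ^ k)` means that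
`f, L f, …, L ^ k f` all lie in `L₂(G)`. -/
def lapPowDomain (k : ℕ) : Set (L2 V) :=
  {f | ∀ j ≤ k, Memℓp ((lap G)^[j] (f : V → ℂ)) 2}

/-- The vector `L ^ k f ∈ L₂(G)` for `f` in the domain of `L ^ k`. -/
def lapPow (k : ℕ) (f : L2 V) (hf : f ∈ lapPowDomain G k) : L2 V :=
  ⟨(lap G)^[k] (f : V → ℂ), hf k le_rfl⟩

end Laplacian

/-- The vertex boundary `bS`: the vertices outside `S` that are adjacent to a vertex of `S`. -/
def vertexBoundary {V : Type u} (G : SimpleGraph V) (S : Set V) : Set V :=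
  {v | v ∉ S ∧ ∃ u ∈ S, G.Adj u v}

/-- The hypotheses of the sampling theorem on `S` and `K₀`: `S ∪ bS = V(G)`, and every vertex of
`bS` is adjacent to at least `K₀ ≥ 1` vertices of `S`. -/
structure IsSamplingSet {V : Type u} (G : SimpleGraph V) (S : Set V) (K₀ : ℕ) : Prop where
  one_le : 1 ≤ K₀
  le_ncard : ∀ v ∈ vertexBoundary G S, K₀ ≤ (G.neighborSet v ∩ S).ncard
  cover : S ∪ vertexBoundary G S = Set.univ

/-- A spectral Fourier transform of the Laplacian `L`: a unitary operator from `L₂(G)` onto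
some `L²(X, μ)` that carries `L`, with its domain, to multiplication by a measurable function
`freq ≥ 0`, the spectral variable. -/
structure SpectralTransform {V : Type u} (G : SimpleGraph V) [G.LocallyFinite]
    {X : Type w} [MeasurableSpace X] (μ : Measure X) where
  /-- the spectral variable `λ` -/
  freq : X → ℝ
  measurable_freq : Measurable freq
  freq_nonneg : ∀ x, 0 ≤ freq x
  /-- the unitary operator -/
  toIso : L2 V ≃ₗᵢ[ℂ] Lp ℂ 2 μ
  mem_domain_iff : ∀ f : L2 V, f ∈ lapPowDomain G 1 ↔
    MemLp (fun x => (freq x : ℂ) * (toIso f : X → ℂ) x) 2 μ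
  map_lap : ∀ (f : L2 V) (hf : f ∈ lapPowDomain G 1),
    (toIso (lapPow G 1 f hf) : X → ℂ) =ᵐ[μ] fun x => (freq x : ℂ) * (toIso f : X → ℂ) x

namespace SpectralTransform

variable {V : Type u} {G : SimpleGraph V} [G.LocallyFinite]
  {X : Type w} [MeasurableSpace X] {μ : Measure X} (T : SpectralTransform G μ)

/-- The Paley-Wiener space `PW_ω(L)`: the functions in `L₂(G)` whose spectral Fourier transform
is supported where the spectral variable lies in `[0, ω]`. -/
def PW (ω : ℝ) : Submodule ℂ (L2 V) where
  carrier := {f | ∀ᵐ x ∂μ, ω < T.freq x → (T.toIso f : X → ℂ) x = 0}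
  zero_mem' := by
    simp only [Set.mem_ofPred_eq, map_zero]
    filter_upwards [Lp.coeFn_zero ℂ 2 μ] with x hx _
    simpa using hx
  add_mem' := by
    intro f g hf hg
    simp only [Set.mem_ofPred_eq, map_add] at hf hg ⊢
    filter_upwards [hf, hg, Lp.coeFn_add (T.toIso f) (T.toIso g)] with x h1 h2 h3 hx
    rw [h3, Pi.add_apply, h1 hx, h2 hx, add_zero]
  smul_mem' := by
    intro c f hf
    simp only [Set.mem_ofPred_eq, map_smul] at hf ⊢
    filter_upwards [hf, Lp.coeFn_smul c (T.toIso f)] with x h1 h2 hx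
    rw [h2, Pi.smul_apply, h1 hx, smul_zero]

theorem isClosed_PW (ω : ℝ) : IsClosed (T.PW ω : Set (L2 V)) := by
  have hs : MeasurableSet {x | ω < T.freq x} := measurableSet_lt measurable_const T.measurable_freq
  have : (T.PW ω : Set (L2 V)) =
      (fun f => LpToLpRestrictCLM X ℂ ℂ μ 2 {x | ω < T.freq x} (T.toIso f)) ⁻¹' {0} := by
    ext f
    simp only [Set.mem_preimage, Set.mem_singleton_iff]
    rw [Lp.eq_zero_iff_ae_eq_zero]
    have h := LpToLpRestrictCLM_coeFn ℂ {x | ω < T.freq x} (T.toIso f)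
    have h0 : f ∈ T.PW ω ↔
        ∀ᵐ x ∂(μ.restrict {x | ω < T.freq x}), (T.toIso f : X → ℂ) x = 0 :=
      (ae_restrict_iff' (μ := μ) (p := fun x => (T.toIso f : X → ℂ) x = 0) hs).symm
    rw [SetLike.mem_coe, h0]
    constructor
    · intro h1
      filter_upwards [h, h1] with x h2 h3
      rw [h2, h3]; rfl
    · intro h1
      filter_upwards [h, h1] with x h2 h3
      rw [← h2, h3]; rfl
  rw [this]
  exact isClosed_singleton.preimage
    ((LpToLpRestrictCLM X ℂ ℂ μ 2 _).continuous.comp T.toIso.continuous)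

instance (ω : ℝ) : CompleteSpace (T.PW ω) := (T.isClosed_PW ω).completeSpace_coe

theorem memLp_exp_mul (t : ℝ) (g : Lp ℂ 2 μ) :
    MemLp (fun x => Complex.exp (Complex.I * t * T.freq x) * (g : X → ℂ) x) 2 μ := by
  refine (Lp.memLp g).of_le ?_ (Filter.Eventually.of_forall fun x => ?_)
  · have hf := T.measurable_freq
    exact AEStronglyMeasurable.mul (by fun_prop) (Lp.aestronglyMeasurable g)
  · have : Complex.I * t * T.freq x = ((t * T.freq x : ℝ) : ℂ) * Complex.I := by
      push_cast; ring
    rw [norm_mul, this, Complex.norm_exp_ofReal_mul_I, one_mul]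

/-- The Schrödinger group `e^{itL}`: multiplication by `e^{itλ}` on the spectral side. -/
def expGroup (t : ℝ) (f : L2 V) : L2 V :=
  T.toIso.symm ((T.memLp_exp_mul t (T.toIso f)).toLp _)

/-- The difference operator `Δ^m_s f = ∑_{j=0}^m (-1)^{m+j} C(m,j) e^{ijsL} f`. -/
def diff (m : ℕ) (s : ℝ) (f : L2 V) : L2 V :=
  ∑ j ∈ Finset.range (m + 1), ((-1 : ℂ) ^ (m + j) * (m.choose j : ℂ)) • T.expGroup (j * s) f

/-- The modulus of continuity `Ω_m(f, s) = sup_{|τ| ≤ s} ‖Δ^m_τ f‖`. -/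
def modulus (m : ℕ) (f : L2 V) (s : ℝ) : ℝ :=
  sSup ((fun τ => ‖T.diff m τ f‖) '' {τ : ℝ | |τ| ≤ s})

end SpectralTransform

/-- The kernel `h(t) = a (sin (t/n) / t)^n`, normalized by the constant `a` to have integral `1`
(the value at the single point `t = 0` plays no role). -/
def kernel (n : ℕ) (t : ℝ) : ℝ :=
  (∫ s : ℝ, (Real.sin (s / n) / s) ^ n)⁻¹ * (Real.sin (t / n) / t) ^ n

namespace SpectralTransform

variable {V : Type u} {G : SimpleGraph V} [G.LocallyFinite]
  {X : Type w} [MeasurableSpace X] {μ : Measure X} (T : SpectralTransform G μ)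

/-- The integrand `h(t) {(-1)^{m-1} Δ^m_{t/ω} f + f}` of the filtering operator. -/
def filterIntegrand (n m : ℕ) (ω : ℝ) (f : L2 V) (t : ℝ) : L2 V :=
  (kernel n t : ℂ) • ((-1 : ℂ) ^ (m + 1) • T.diff m (t / ω) f + f)

/-- The filtering operator `P_h^{ω,m} f = ∫ h(t) {(-1)^{m-1} Δ^m_{t/ω} f + f} dt`
(a Bochner integral in `L₂(G)`). -/
def filterOp (n m : ℕ) (ω : ℝ) (f : L2 V) : L2 V := ∫ t : ℝ, T.filterIntegrand n m ω f t

/-- `Θ` is a family of reconstructing functions for `PW_ω(L)` on `S`: every `Θ_u` lies in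
`PW_ω(L)`, and `f = ∑_{u ∈ S} f(u) Θ_u`, with unconditional convergence in `L₂(G)`, for all
`f ∈ PW_ω(L)`. -/
structure IsReconstructing (ω : ℝ) (S : Set V) (Θ : S → L2 V) : Prop where
  mem_PW : ∀ u, Θ u ∈ T.PW ω
  hasSum : ∀ f ∈ T.PW ω, HasSum (fun u : S => (f : V → ℂ) u • Θ u) f

end SpectralTransform

end GraphSampling

end

open GraphSampling

-- On the spectral side every operator is multiplication by a function of `λ`. Inside the braces of
-- `P_h^{ω,m} f` the `j = 0` term of the difference cancels `f`, leaving a combination of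
-- `e^{ijtL/ω} f` with `j ≥ 1`. The Fourier transform of `h` vanishes outside `[-1, 1]`
-- (`integral_kernel_mul_exp`), so integration kills every frequency `λ > ω` (`filterOp_mem_PW`).
-- Any reconstructing family therefore returns both `P_h^{ω,m} f` and `f_ω` unchanged, and the first
-- inequality is the minimality of the orthogonal projection. For the second, `∫ h = 1` gives `f -
-- P_h^{ω,m} f = ± ∫ h(t) Δ^m_{t/ω} f dt`. The bound `|e^{iτλ} - 1|^k ≤ |τλ|^k` trades `k`
-- differences for `L^k`, and `|z^N - 1| ≤ N |z - 1|` on the unit circle trades the step `t/ω` for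
-- one of size at most `1/ω`; the resulting weight `(1 + |t|)^m` is absorbed by the decay of `h`
-- (`norm_sub_filterOp_le`).
--
-- Reconstruction (`exists_isReconstructing`) compares `g(v)` with its values at `K₀` neighbors in
-- `S`. A function in `PW_ω(L)` has energy at most `2ω‖g‖²`, each edge counted twice, so `(K₀ -
-- 4ω)‖g‖²` is controlled by the samples, and a bounded left inverse of the sampling map yields the
-- `Θ_u`.
--
-- Since `L` may be unbounded, the spectral transform comes from diagonalizing `(L + 1)⁻¹`. A
-- maximum principle shows that `L + 1` is injective on the maximal domain and has dense range on
-- finitely supported functions. The resolvent, extended from there, also carries the energy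
-- inequality to the maximal domain.

noncomputable section

namespace GraphSampling

-- The resolvent of the Laplacian and the energy inequality.

section Resolvent

variable {V : Type u} (G : SimpleGraph V) [G.LocallyFinite]

theorem lap_add (f g : V → ℂ) : lap G (f + g) = lap G f + lap G g := by
  funext v
  simp only [lap, Pi.add_apply, ← Finset.sum_add_distrib]
  exact Finset.sum_congr rfl fun _ _ => by ring

theorem tendsto_norm_cofinite_zero (h : L2 V) :
    Filter.Tendsto (fun v => ‖h v‖) Filter.cofinite (nhds 0) := by
  have h1 := (lp.memℓp h).summable (by norm_num : 0 < (2 : ENNReal).toReal)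
  have h2 := h1.tendsto_cofinite_zero
  have h3 := (Real.continuous_sqrt.tendsto 0).comp h2
  simpa [Function.comp_def, Real.sqrt_sq, Real.sqrt_zero] using h3

/-- The maximum principle: `-1` is not an eigenvalue of the Laplacian on its maximal domain. -/
theorem eq_zero_of_lap_add_self_eq_zero (h : L2 V) (hh : ∀ v, lap G h v + h v = 0) : h = 0 := by
  by_contra hne
  obtain ⟨v₀, hv₀⟩ : ∃ v, h v ≠ 0 := by
    by_contra! hc
    exact hne (lp.ext (funext fun v => by simpa using hc v))
  -- `|h|` tends to zero at infinity, so it attains its maximum at some `v`. There `(deg v + 1)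
  -- h(v)` is the sum of the neighboring values, of modulus at most `deg v · |h(v)|`.
  have hfin : {v | ‖h v₀‖ ≤ ‖h v‖}.Finite := by
    have := (tendsto_norm_cofinite_zero h).eventually (gt_mem_nhds (norm_pos_iff.mpr hv₀))
    simpa [Filter.eventually_cofinite, not_lt] using this
  obtain ⟨v, hv, hmax⟩ := hfin.exists_maximalFor (fun v => ‖h v‖) _ ⟨v₀, le_refl ‖h v₀‖⟩
  have hmax' : ∀ u, ‖h u‖ ≤ ‖h v‖ := by
    intro u
    by_contra! hu
    exact absurd (hmax (hv.trans hu.le) hu.le) (not_le.mpr hu)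
  have hpos : 0 < ‖h v‖ := (norm_pos_iff.mpr hv₀).trans_le hv
  have key : ((G.neighborFinset v).card + 1 : ℂ) * h v = ∑ u ∈ G.neighborFinset v, h u := by
    have := hh v
    simp only [lap, Finset.sum_sub_distrib, Finset.sum_const, nsmul_eq_mul] at this
    linear_combination this
  have h1 : ((G.neighborFinset v).card + 1 : ℝ) * ‖h v‖ ≤ (G.neighborFinset v).card * ‖h v‖ := by
    calc ((G.neighborFinset v).card + 1 : ℝ) * ‖h v‖
        = ‖((G.neighborFinset v).card + 1 : ℂ) * h v‖ := by
          rw [norm_mul]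
          congr 1
          norm_cast
      _ ≤ ∑ u ∈ G.neighborFinset v, ‖h u‖ := key ▸ norm_sum_le _ _
      _ ≤ ∑ u ∈ G.neighborFinset v, ‖h v‖ := Finset.sum_le_sum fun u _ => hmax' u
      _ = _ := by simp
  linarith

open Classical in
/-- The delta function at `v`. -/
def delta (v : V) : L2 V := lp.single 2 v 1

theorem inner_delta (v : V) (h : L2 V) : inner ℂ (delta v) h = h v := by
  classical
  rw [delta, lp.inner_single_left]
  simp

open Classical in
theorem delta_apply (v w : V) : delta v w = if w = v then 1 else 0 := by
  simp [delta, lp.single_apply, Pi.single_apply]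

/-- The vector `(L + 1) δ_v`. -/
def lapAddOneDelta (v : V) : L2 V :=
  ((G.neighborFinset v).card + 1 : ℂ) • delta v - ∑ u ∈ G.neighborFinset v, delta u

/-- Evaluating the formal `L + 1` at a vertex is a bounded functional, even when `L` is unbounded;
pointwise identities for `L` thus extend by density. -/
theorem inner_lapAddOneDelta (v : V) (h : L2 V) :
    inner ℂ (lapAddOneDelta G v) h = lap G h v + h v := by
  have hc : (starRingEnd ℂ) ((G.neighborFinset v).card + 1 : ℂ) =
      (G.neighborFinset v).card + 1 := by
    simp
  simp only [lapAddOneDelta, inner_sub_left, inner_smul_left, sum_inner, inner_delta, hc, lap,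
    Finset.sum_sub_distrib, Finset.sum_const, nsmul_eq_mul]
  ring

/-- Finitely supported functions as elements of `L₂(G)`. -/
def ofFinsupp : (V →₀ ℂ) →ₗ[ℂ] L2 V := Finsupp.linearCombination ℂ delta

theorem ofFinsupp_apply (φ : V →₀ ℂ) (v : V) : ofFinsupp φ v = φ v := by
  classical
  rw [← inner_delta, ofFinsupp, Finsupp.linearCombination_apply, Finsupp.sum, inner_sum]
  simp only [inner_smul_right, inner_delta, delta_apply]
  simp [Finset.sum_ite_eq, eq_comm]

/-- The operator `L + 1` on finitely supported functions. -/
def lapAddOne : (V →₀ ℂ) →ₗ[ℂ] L2 V := Finsupp.linearCombination ℂ (lapAddOneDelta G)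

theorem lapAddOne_apply (φ : V →₀ ℂ) (v : V) :
    lapAddOne G φ v = lap G φ v + φ v := by
  classical
  induction φ using Finsupp.induction_linear with
  | zero => simp [lap]
  | add f g hf hg =>
    rw [map_add, lp.coeFn_add, Pi.add_apply, hf, hg, Finsupp.coe_add, lap_add]
    simp only [Pi.add_apply]
    ring
  | single w c =>
    rw [lapAddOne, Finsupp.linearCombination_single, lp.coeFn_smul, Pi.smul_apply, smul_eq_mul,
      ← inner_delta, lapAddOneDelta, inner_sub_right, inner_smul_right, inner_sum]
    simp only [inner_delta, delta_apply, lap, Finsupp.single_apply, Finset.sum_sub_distrib,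
      Finset.sum_const, nsmul_eq_mul, Finset.sum_ite_eq, Finset.sum_ite_eq', eq_comm (a := w),
      SimpleGraph.mem_neighborFinset, G.adj_comm v w]
    by_cases h1 : v = w
    · subst h1; simp; ring
    · by_cases h2 : G.Adj w v <;> simp [h1, h2]

/-- A vector orthogonal to every `(L + 1) δ_v` solves `L h + h = 0` pointwise, which the maximum
principle excludes. -/
theorem denseRange_lapAddOne : DenseRange (lapAddOne G) := by
  have : (LinearMap.range (lapAddOne G)).topologicalClosure = ⊤ := by
    rw [Submodule.topologicalClosure_eq_top_iff, eq_bot_iff]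
    intro h hh
    rw [Submodule.mem_orthogonal] at hh
    refine eq_zero_of_lap_add_self_eq_zero G h fun v => ?_
    rw [← inner_lapAddOneDelta]
    refine hh _ ⟨Finsupp.single v 1, ?_⟩
    simp [lapAddOne]
  exact Submodule.dense_iff_topologicalClosure_eq_top.mpr this

open Classical in
-- Green's identity. The set `s` has to contain the support and its neighbors, so that no edge with
-- a nonzero difference is lost.
theorem inner_ofFinsupp_lapAddOne (φ : V →₀ ℂ) (s : Finset V) (hs : φ.support ⊆ s)
    (hs' : ∀ v ∈ φ.support, G.neighborFinset v ⊆ s) :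
    2 * inner ℂ (ofFinsupp φ) (lapAddOne G φ) = ((2 * ‖ofFinsupp φ‖ ^ 2 +
      ∑ v ∈ s, ∑ u ∈ s, if G.Adj v u then ‖φ u - φ v‖ ^ 2 else 0 : ℝ) : ℂ) := by
  have e1 : inner ℂ (ofFinsupp φ) (lapAddOne G φ) =
      ∑ v ∈ s, (starRingEnd ℂ (φ v)) * (lap G φ v + φ v) := by
    rw [ofFinsupp, Finsupp.linearCombination_apply,
      Finsupp.sum_of_support_subset _ hs _ (by simp), sum_inner]
    simp only [inner_smul_left, inner_delta, lapAddOne_apply]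
  have e2 : ((‖ofFinsupp φ‖ ^ 2 : ℝ) : ℂ) = ∑ v ∈ s, (starRingEnd ℂ (φ v)) * φ v := by
    have := inner_self_eq_norm_sq_to_K (𝕜 := ℂ) (ofFinsupp φ)
    push_cast
    rw [← Complex.coe_algebraMap, ← this]
    conv_lhs =>
      arg 2
      rw [ofFinsupp, Finsupp.linearCombination_apply,
        Finsupp.sum_of_support_subset _ hs _ (by simp)]
    rw [sum_inner]
    simp only [inner_smul_left, inner_delta, ofFinsupp_apply]
  have e3 : ∀ v ∈ s, (starRingEnd ℂ (φ v)) * lap G φ v =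
      ∑ u ∈ s, if G.Adj v u then (starRingEnd ℂ (φ v)) * (φ v - φ u) else 0 := by
    intro v _
    by_cases hv : v ∈ φ.support
    · rw [← Finset.sum_filter, lap, Finset.mul_sum]
      refine Finset.sum_congr ?_ fun _ _ => rfl
      ext u
      simp only [SimpleGraph.mem_neighborFinset, Finset.mem_filter]
      exact ⟨fun h => ⟨hs' v hv (by simpa using h), h⟩, fun h => h.2⟩
    · simp [Finsupp.notMem_support_iff.mp hv]
  have e4 : ∑ v ∈ s, (starRingEnd ℂ (φ v)) * lap G φ v =
      ∑ v ∈ s, ∑ u ∈ s, if G.Adj v u then (starRingEnd ℂ (φ v)) * (φ v - φ u) else 0 :=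
    Finset.sum_congr rfl e3
  -- Exchanging the endpoints of each edge; the average of the two orientations produces `|φ u - φ
  -- v|²`.
  have e5 : ∑ v ∈ s, (starRingEnd ℂ (φ v)) * lap G φ v =
      ∑ v ∈ s, ∑ u ∈ s, if G.Adj v u then (starRingEnd ℂ (φ u)) * (φ u - φ v) else 0 := by
    rw [e4, Finset.sum_comm]
    simp only [G.adj_comm]
  have e6 : ∀ z : ℂ, ((‖z‖ ^ 2 : ℝ) : ℂ) = starRingEnd ℂ z * z := fun z => by
    rw [← Complex.normSq_eq_norm_sq, Complex.normSq_eq_conj_mul_self]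
  have e7 : 2 * ∑ v ∈ s, (starRingEnd ℂ (φ v)) * lap G φ v =
      ((∑ v ∈ s, ∑ u ∈ s, if G.Adj v u then ‖φ u - φ v‖ ^ 2 else 0 : ℝ) : ℂ) := by
    rw [two_mul]
    nth_rw 1 [e4]
    rw [e5, ← Finset.sum_add_distrib, Complex.ofReal_sum]
    refine Finset.sum_congr rfl fun v _ => ?_
    rw [← Finset.sum_add_distrib, Complex.ofReal_sum]
    refine Finset.sum_congr rfl fun u _ => ?_
    split_ifs with h
    · rw [e6, map_sub]; ring
    · simp
  rw [Complex.ofReal_add, ← e7, Complex.ofReal_mul, e2, e1]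
  simp only [mul_add, Finset.sum_add_distrib]
  push_cast
  ring

/-- Restricting the energy to a finite `F` turns Green's identity into a closed condition on `(L +
1) φ`, which survives passage to the limit. -/
theorem energy_ofFinsupp_le (φ : V →₀ ℂ) (F : Finset V) :
    2 * ‖ofFinsupp φ‖ ^ 2 + ∑ v ∈ F, ∑ u ∈ G.neighborFinset v, ‖φ u - φ v‖ ^ 2 ≤
      2 * (inner ℂ (ofFinsupp φ) (lapAddOne G φ)).re ∧
    (inner ℂ (ofFinsupp φ) (lapAddOne G φ)).im = 0 := by
  classical
  set s : Finset V := (φ.support ∪ F) ∪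
    (φ.support ∪ F).biUnion (fun v => G.neighborFinset v) with hs
  have h := inner_ofFinsupp_lapAddOne G φ s
    (fun v hv => by simp only [hs, Finset.mem_union]; exact Or.inl (Or.inl hv))
    (fun v hv u hu => by
      simp only [hs, Finset.mem_union, Finset.mem_biUnion]
      exact Or.inr ⟨v, Or.inl hv, hu⟩)
  have hre := congrArg Complex.re h
  have him := congrArg Complex.im h
  rw [Complex.ofReal_re] at hre
  rw [Complex.ofReal_im] at him
  simp only [Complex.mul_re, Complex.mul_im, Complex.re_ofNat, Complex.im_ofNat] at hre him
  constructor
  · have : ∑ v ∈ F, ∑ u ∈ G.neighborFinset v, ‖φ u - φ v‖ ^ 2 ≤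
        ∑ v ∈ s, ∑ u ∈ s, if G.Adj v u then ‖φ u - φ v‖ ^ 2 else 0 := by
      refine (Finset.sum_le_sum fun v hv => ?_).trans
        (Finset.sum_le_sum_of_subset_of_nonneg (fun v hv => ?_) fun v _ _ => ?_)
      · rw [← Finset.sum_filter]
        refine Finset.sum_le_sum_of_subset_of_nonneg (fun u hu => ?_) fun _ _ _ => by positivity
        simp only [Finset.mem_filter, hs, Finset.mem_union, Finset.mem_biUnion]
        exact ⟨Or.inr ⟨v, Or.inr hv, hu⟩, by simpa using hu⟩
      · simp only [hs, Finset.mem_union]; exact Or.inl (Or.inr hv)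
      · exact Finset.sum_nonneg fun u _ => by split_ifs <;> positivity
    linarith
  · linarith

theorem norm_ofFinsupp_le (φ : V →₀ ℂ) : ‖ofFinsupp φ‖ ≤ 1 * ‖lapAddOne G φ‖ := by
  have h := (energy_ofFinsupp_le G φ ∅).1
  have h1 : (inner ℂ (ofFinsupp φ) (lapAddOne G φ)).re ≤ ‖ofFinsupp φ‖ * ‖lapAddOne G φ‖ :=
    (Complex.re_le_norm _).trans (norm_inner_le_norm _ _)
  simp only [Finset.sum_empty, add_zero] at h
  rw [one_mul]
  rcases (norm_nonneg (ofFinsupp φ)).eq_or_lt with h0 | h0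
  · rw [← h0]; positivity
  · nlinarith

/-- The resolvent `(L + 1)⁻¹`. -/
def resolv : L2 V →L[ℂ] L2 V := ofFinsupp.extendOfNorm (lapAddOne G)

theorem resolv_lapAddOne (φ : V →₀ ℂ) : resolv G (lapAddOne G φ) = ofFinsupp φ :=
  LinearMap.extendOfNorm_eq (denseRange_lapAddOne G) ⟨1, norm_ofFinsupp_le G⟩ φ

theorem lap_resolv (g : L2 V) (v : V) : lap G (resolv G g) v + resolv G g v = g v := by
  rw [← inner_lapAddOneDelta, ← inner_delta]
  refine (denseRange_lapAddOne G).induction_on (p := fun g : L2 V =>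
    inner ℂ (lapAddOneDelta G v) (resolv G g) = inner ℂ (delta v) g) g
    (isClosed_eq (by fun_prop) (by fun_prop)) fun φ => ?_
  rw [resolv_lapAddOne, inner_lapAddOneDelta, inner_delta, lapAddOne_apply]
  have : (ofFinsupp φ : V → ℂ) = φ := funext (ofFinsupp_apply φ)
  rw [this]

theorem energy_resolv_le (g : L2 V) (F : Finset V) :
    2 * ‖resolv G g‖ ^ 2 +
        ∑ v ∈ F, ∑ u ∈ G.neighborFinset v, ‖resolv G g u - resolv G g v‖ ^ 2 ≤
      2 * (inner ℂ (resolv G g) g).re := by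
  simp only [← inner_delta _ (resolv G g)]
  refine (denseRange_lapAddOne G).induction_on (p := fun g : L2 V => 2 * ‖resolv G g‖ ^ 2 +
      ∑ v ∈ F, ∑ u ∈ G.neighborFinset v,
        ‖inner ℂ (delta u) (resolv G g) - inner ℂ (delta v) (resolv G g)‖ ^ 2 ≤
      2 * (inner ℂ (resolv G g) g).re) g (isClosed_le (by fun_prop) ?_) fun φ => ?_
  · exact continuous_const.mul (Complex.continuous_re.comp (by fun_prop))
  · rw [resolv_lapAddOne]
    simpa only [inner_delta, ofFinsupp_apply] using (energy_ofFinsupp_le G φ F).1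

theorem isPositive_resolv : (resolv G).IsPositive := by
  rw [ContinuousLinearMap.isPositive_iff_complex]
  intro g
  have him : (inner ℂ (resolv G g) g).im = 0 :=
    (denseRange_lapAddOne G).induction_on (p := fun g : L2 V => (inner ℂ (resolv G g) g).im = 0) g
      (isClosed_eq (Complex.continuous_im.comp (by fun_prop)) continuous_const) fun φ => by
        rw [resolv_lapAddOne]; exact (energy_ofFinsupp_le G φ ∅).2
  have hre := energy_resolv_le G g ∅
  refine ⟨Complex.ext (by simp) (by simp [him]), ?_⟩
  simp only [Finset.sum_empty, add_zero] at hre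
  have := sq_nonneg ‖resolv G g‖
  simp only [RCLike.re_eq_complex_re]
  linarith

theorem norm_resolv_le : ‖resolv G‖ ≤ 1 :=
  LinearMap.opNorm_extendOfNorm_le (denseRange_lapAddOne G) zero_le_one (norm_ofFinsupp_le G)

theorem mem_lapPowDomain_one (f : L2 V) : f ∈ lapPowDomain G 1 ↔ Memℓp (lap G f) 2 := by
  constructor
  · intro h; exact h 1 le_rfl
  · intro h j hj
    interval_cases j
    · exact lp.memℓp f
    · exact h

theorem lapPow_one_apply (f : L2 V) (hf : f ∈ lapPowDomain G 1) (v : V) :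
    lapPow G 1 f hf v = lap G f v := rfl

theorem resolv_mem (g : L2 V) : resolv G g ∈ lapPowDomain G 1 := by
  rw [mem_lapPowDomain_one]
  have : lap G (resolv G g) = (g - resolv G g : L2 V) := by
    funext v
    rw [lp.coeFn_sub, Pi.sub_apply, ← lap_resolv G g v]
    ring
  rw [this]
  exact lp.memℓp _

/-- The difference of the two sides is annihilated by `L + 1`. Hence the maximal domain is exactly
the range of the resolvent. -/
theorem resolv_lapPow_add (f : L2 V) (hf : f ∈ lapPowDomain G 1) :
    resolv G (lapPow G 1 f hf + f) = f := by
  rw [← sub_eq_zero]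
  refine eq_zero_of_lap_add_self_eq_zero G _ fun v => ?_
  have h := lap_resolv G (lapPow G 1 f hf + f) v
  rw [← inner_lapAddOneDelta] at h ⊢
  rw [inner_sub_right, h, inner_lapAddOneDelta]
  simp [lapPow_one_apply]

theorem resolv_injective : Function.Injective (resolv G) := by
  refine (injective_iff_map_eq_zero _).mpr fun g hg => lp.ext (funext fun v => ?_)
  rw [← lap_resolv G g v, hg]
  simp [lap]

/-- Write `f` as the resolvent of `(L + 1) f`; the two terms `2‖f‖²` then cancel. -/
theorem energy_le (f : L2 V) (hf : f ∈ lapPowDomain G 1) (F : Finset V) :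
    ∑ v ∈ F, ∑ u ∈ G.neighborFinset v, ‖f u - f v‖ ^ 2 ≤
      2 * (inner ℂ f (lapPow G 1 f hf)).re := by
  have h := energy_resolv_le G (lapPow G 1 f hf + f) F
  rw [resolv_lapPow_add, inner_add_right, Complex.add_re] at h
  have h2 : (inner ℂ f f).re = ‖f‖ ^ 2 := by
    rw [inner_self_eq_norm_sq_to_K]; norm_cast
  linarith

end Resolvent

-- Bounded multiplication operators on `L²`.

section Multiplication

variable {X : Type*} [MeasurableSpace X] {μ : Measure X}

theorem memLp_bdd_mul {φ : X → ℂ} (hφ : Measurable φ) {C : ℝ} (hC : ∀ x, ‖φ x‖ ≤ C)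
    (g : Lp ℂ 2 μ) : MemLp (fun x => φ x * (g : X → ℂ) x) 2 μ :=
  (Lp.memLp g).of_le_mul (c := C) (hφ.aestronglyMeasurable.mul (Lp.aestronglyMeasurable g))
    (Filter.Eventually.of_forall fun x => by
      rw [norm_mul]; exact mul_le_mul_of_nonneg_right (hC x) (norm_nonneg _))

/-- Multiplication by a bounded measurable function, as an operator on `L²(X, μ)`. -/
def mulCLM (φ : X → ℂ) (hφ : Measurable φ) (C : ℝ) (hC : ∀ x, ‖φ x‖ ≤ C) :
    Lp ℂ 2 μ →L[ℂ] Lp ℂ 2 μ :=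
  LinearMap.mkContinuous
    { toFun := fun g => (memLp_bdd_mul hφ hC g).toLp _
      map_add' := fun f g => by
        rw [← MemLp.toLp_add]
        refine MemLp.toLp_congr _ _ ?_
        filter_upwards [Lp.coeFn_add f g] with x hx
        simp only [hx, Pi.add_apply]
        ring
      map_smul' := fun c g => by
        rw [RingHom.id_apply, ← MemLp.toLp_const_smul]
        refine MemLp.toLp_congr _ _ ?_
        filter_upwards [Lp.coeFn_smul c g] with x hx
        simp only [hx, Pi.smul_apply, smul_eq_mul]
        ring }
    C (fun g => by
      refine Lp.norm_le_mul_norm_of_ae_le_mul ?_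
      filter_upwards [MemLp.coeFn_toLp (memLp_bdd_mul hφ hC g)] with x hx
      simp only [LinearMap.coe_mk, AddHom.coe_mk]
      rw [hx, norm_mul]
      exact mul_le_mul_of_nonneg_right (hC x) (norm_nonneg _))

theorem mulCLM_coeFn (φ : X → ℂ) (hφ : Measurable φ) (C : ℝ) (hC : ∀ x, ‖φ x‖ ≤ C)
    (g : Lp ℂ 2 μ) :
    (mulCLM φ hφ C hC g : X → ℂ) =ᵐ[μ] fun x => φ x * (g : X → ℂ) x :=
  MemLp.coeFn_toLp (memLp_bdd_mul hφ hC g)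

end Multiplication

-- Unitaries from equal Gram matrices.

section Gram

variable {H K : Type*} [NormedAddCommGroup H] [InnerProductSpace ℂ H] [CompleteSpace H]
  [NormedAddCommGroup K] [InnerProductSpace ℂ K] [CompleteSpace K]

/-- Two total families with the same Gram matrix are related by a unitary operator. -/
theorem exists_unitary_of_gram_eq {I : Type*} (a : I → H) (b : I → K)
    (ha : (Submodule.span ℂ (Set.range a)).topologicalClosure = ⊤)
    (hb : (Submodule.span ℂ (Set.range b)).topologicalClosure = ⊤)
    (hab : ∀ i j, inner ℂ (a i) (a j) = inner ℂ (b i) (b j)) :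
    ∃ U : H ≃ₗᵢ[ℂ] K, ∀ i, U (a i) = b i := by
  have hn : ∀ x : I →₀ ℂ,
      ‖Finsupp.linearCombination ℂ b x‖ = ‖Finsupp.linearCombination ℂ a x‖ := by
    intro x
    have : inner ℂ (Finsupp.linearCombination ℂ b x) (Finsupp.linearCombination ℂ b x) =
        inner ℂ (Finsupp.linearCombination ℂ a x) (Finsupp.linearCombination ℂ a x) := by
      simp only [Finsupp.linearCombination_apply, Finsupp.sum, sum_inner, inner_sum,
        inner_smul_left, inner_smul_right, hab]
    rw [inner_self_eq_norm_sq_to_K, inner_self_eq_norm_sq_to_K] at this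
    have h2 : ‖Finsupp.linearCombination ℂ b x‖ ^ 2 = ‖Finsupp.linearCombination ℂ a x‖ ^ 2 := by
      exact_mod_cast this
    exact (sq_eq_sq₀ (norm_nonneg _) (norm_nonneg _)).mp h2
  have hda : DenseRange (Finsupp.linearCombination ℂ a) := by
    have := Submodule.dense_iff_topologicalClosure_eq_top.mpr ha
    rwa [← Finsupp.range_linearCombination] at this
  have hdb : DenseRange (Finsupp.linearCombination ℂ b) := by
    have := Submodule.dense_iff_topologicalClosure_eq_top.mpr hb
    rwa [← Finsupp.range_linearCombination] at this
  refine ⟨(LinearEquiv.refl ℂ (I →₀ ℂ)).extendOfIsometry _ _ hda hdb hn, fun i => ?_⟩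
  have := (LinearEquiv.refl ℂ (I →₀ ℂ)).extendOfIsometry_eq _ _ hda hdb hn (Finsupp.single i 1)
  simpa using this

end Gram

-- Spectral measures and the multiplication form, from orthogonal cyclic subspaces.

section Spectral

variable {H : Type*} [NormedAddCommGroup H] [InnerProductSpace ℂ H] [CompleteSpace H]
  {A : H →L[ℂ] H} (hA : IsSelfAdjoint A)

theorem inner_cfcHom_cfcHom (e : H) (f g : C(spectrum ℝ A, ℝ)) :
    inner ℂ (cfcHom hA f e) (cfcHom hA g e) = inner ℂ e (cfcHom hA (f * g) e) := by
  have hs : star (cfcHom hA f) = cfcHom hA f := by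
    rw [← map_star, star_trivial]
  rw [map_mul, mul_apply_eq_comp]
  nth_rw 1 [← hs]
  rw [ContinuousLinearMap.star_eq_adjoint, ContinuousLinearMap.adjoint_inner_left]

theorem inner_cfcHom_im (e : H) (f : C(spectrum ℝ A, ℝ)) :
    (inner ℂ e (cfcHom hA f e)).im = 0 := by
  have hs : IsSelfAdjoint (cfcHom hA f) := by
    rw [isSelfAdjoint_iff, ← map_star, star_trivial]
  rw [← Complex.conj_eq_iff_im, inner_conj_symm]
  exact hs.isSymmetric e e

theorem inner_cfcHom_nonneg (e : H) (f : C(spectrum ℝ A, ℝ)) (hf : ∀ x, 0 ≤ f x) :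
    0 ≤ (inner ℂ e (cfcHom hA f e)).re := by
  let g : C(spectrum ℝ A, ℝ) := ⟨fun x => Real.sqrt (f x), by fun_prop⟩
  have : f = g * g := by
    ext x
    exact (Real.mul_self_sqrt (hf x)).symm
  rw [this, ← inner_cfcHom_cfcHom]
  exact inner_self_nonneg (𝕜 := ℂ)

open scoped CompactlySupported in
/-- The spectral measure of a vector. -/
theorem exists_spectral_measure (e : H) :
    ∃ μ : Measure (spectrum ℝ A), μ.Regular ∧ IsFiniteMeasure μ ∧
      ∀ f : C(spectrum ℝ A, ℝ), ((∫ x, f x ∂μ : ℝ) : ℂ) = inner ℂ e (cfcHom hA f e) := by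
  let Λ₀ : C_c(spectrum ℝ A, ℝ) →ₗ[ℝ] ℝ :=
    { toFun := fun f => (inner ℂ e (cfcHom hA f.toContinuousMap e)).re
      map_add' := fun f g => by
        have : (f + g).toContinuousMap = f.toContinuousMap + g.toContinuousMap := rfl
        rw [this, map_add, add_apply, inner_add_right, Complex.add_re]
      map_smul' := fun c f => by
        have : (c • f).toContinuousMap = c • f.toContinuousMap := rfl
        rw [this, map_smul, smul_apply, inner_smul_right_eq_smul]
        simp }
  let Λ : C_c(spectrum ℝ A, ℝ) →ₚ[ℝ] ℝ :=
    { Λ₀ with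
      monotone' := fun f g hfg => by
        have h : 0 ≤ Λ₀ (g - f) := inner_cfcHom_nonneg hA e _ fun x => sub_nonneg.mpr (hfg x)
        rw [map_sub] at h
        exact sub_nonneg.mp h }
  refine ⟨RealRMK.rieszMeasure Λ, inferInstance, inferInstance, fun f => ?_⟩
  have h := RealRMK.integral_rieszMeasure Λ (CompactlySupportedContinuousMap.continuousMapEquiv f)
  refine Complex.ext ?_ ?_
  · rw [Complex.ofReal_re]
    exact h
  · rw [Complex.ofReal_im, inner_cfcHom_im]

/-- The orthogonal sum of cyclic subspaces: multiplication form, given cyclic vectors with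
mutually orthogonal cyclic subspaces. -/
theorem exists_multiplication_form_of_cyclic {V : Type*} [Countable V] [MeasurableSpace V]
    [MeasurableSingletonClass V] (e : V → H)
    (horth : ∀ v w, v ≠ w → ∀ f g : C(spectrum ℝ A, ℝ),
      inner ℂ (cfcHom hA f (e v)) (cfcHom hA g (e w)) = 0)
    (htot : (Submodule.span ℂ (Set.range fun p : V × C(spectrum ℝ A, ℝ) =>
      cfcHom hA p.2 (e p.1))).topologicalClosure = ⊤) :
    ∃ (μ : Measure (V × spectrum ℝ A)) (U : H ≃ₗᵢ[ℂ] Lp ℂ 2 μ), ∀ h : H,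
      (U (A h) : V × spectrum ℝ A → ℂ) =ᵐ[μ] fun x => ((x.2 : ℝ) : ℂ) * (U h : _ → ℂ) x := by
  choose ν hreg hfin hν using fun v => exists_spectral_measure hA (e v)
  -- One slice for each index `v`, carrying the spectral measure of `e v`.
  set μ : Measure (V × spectrum ℝ A) := Measure.sum fun v => (ν v).map (Prod.mk v) with hμ
  have hemb : ∀ v : V, MeasurableEmbedding (Prod.mk v : spectrum ℝ A → V × spectrum ℝ A) :=
    fun v => measurableEmbedding_prodMk_left v
  have hsm : ∀ v : V, MeasurableSet (Prod.fst ⁻¹' {v} : Set (V × spectrum ℝ A)) :=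
    fun v => measurable_fst (measurableSet_singleton v)
  have hres : ∀ v, μ.restrict (Prod.fst ⁻¹' {v}) = (ν v).map (Prod.mk v) := by
    intro v
    ext t ht
    rw [Measure.restrict_apply ht, hμ, Measure.sum_apply _ (ht.inter (hsm v)), tsum_eq_single v]
    · rw [(hemb v).map_apply, (hemb v).map_apply]
      congr 1
      ext y; simp
    · intro w hw
      rw [(hemb w).map_apply]
      have : (Prod.mk w ⁻¹' (t ∩ Prod.fst ⁻¹' {v}) : Set (spectrum ℝ A)) = ∅ := by
        ext y; simp [hw]
      rw [this, measure_empty]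
  -- The model of `f(A) e_v`: the function `f` on the slice of `v`, zero on the others.
  let b₀ : V × C(spectrum ℝ A, ℝ) → V × spectrum ℝ A → ℂ := fun p =>
    (Prod.fst ⁻¹' {p.1}).indicator fun x => ((p.2 x.2 : ℝ) : ℂ)
  have hb₀m : ∀ p, MemLp (b₀ p) 2 μ := by
    intro p
    rw [memLp_indicator_iff_restrict (hsm p.1), hres, (hemb p.1).memLp_map_measure_iff]
    have h1 : Continuous fun y : spectrum ℝ A => ((p.2 y : ℝ) : ℂ) := by fun_prop
    exact MemLp.of_bound h1.aestronglyMeasurable ‖p.2‖ (Filter.Eventually.of_forall fun y => by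
      rw [Function.comp_apply, Complex.norm_real]; exact p.2.norm_coe_le_norm y)
  let b : V × C(spectrum ℝ A, ℝ) → Lp ℂ 2 μ := fun p => (hb₀m p).toLp _
  have hbc : ∀ p, (b p : _ → ℂ) =ᵐ[μ] b₀ p := fun p => MemLp.coeFn_toLp _
  have hinner : ∀ p (g : Lp ℂ 2 μ),
      inner ℂ (b p) g = ∫ y, ((p.2 y : ℝ) : ℂ) * (g : _ → ℂ) (p.1, y) ∂(ν p.1) := by
    intro p g
    rw [L2.inner_def, ← (hemb p.1).integral_map (μ := ν p.1)
      (fun x => ((p.2 x.2 : ℝ) : ℂ) * (g : _ → ℂ) x), ← hres, ← integral_indicator (hsm p.1)]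
    refine integral_congr_ae ?_
    filter_upwards [hbc p] with x hx
    rw [hx]
    by_cases hxp : x ∈ (Prod.fst ⁻¹' {p.1} : Set (V × spectrum ℝ A))
    · simp only [b₀, Set.indicator_of_mem hxp, RCLike.inner_apply, Complex.conj_ofReal]
      ring
    · simp only [b₀, Set.indicator_of_notMem hxp, RCLike.inner_apply, map_zero, mul_zero]
  have hgram : ∀ p q : V × C(spectrum ℝ A, ℝ),
      inner ℂ (cfcHom hA p.2 (e p.1)) (cfcHom hA q.2 (e q.1)) = inner ℂ (b p) (b q) := by
    rintro ⟨v, f⟩ ⟨w, g⟩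
    rw [hinner]
    have hae : ∀ᵐ y ∂(ν v), (b (w, g) : _ → ℂ) (v, y) = b₀ (w, g) (v, y) := by
      have := ae_restrict_of_ae (s := Prod.fst ⁻¹' {v}) (hbc (w, g))
      rw [hres] at this
      exact (hemb v).ae_map_iff.mp this
    by_cases hvw : v = w
    · subst hvw
      rw [inner_cfcHom_cfcHom, ← hν, ← integral_complex_ofReal]
      refine integral_congr_ae ?_
      filter_upwards [hae] with y hy
      rw [hy]
      simp [b₀]
    · rw [horth v w hvw]
      symm
      refine integral_eq_zero_of_ae ?_
      filter_upwards [hae] with y hy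
      rw [hy]
      simp [b₀, hvw]
  -- A vector orthogonal to all `b p` is, on each slice, orthogonal to the real and imaginary parts
  -- of every continuous function, and these are dense in `L²` of a finite regular measure.
  have hbtot : (Submodule.span ℂ (Set.range b)).topologicalClosure = ⊤ := by
    rw [Submodule.topologicalClosure_eq_top_iff, eq_bot_iff]
    intro g hg
    rw [Submodule.mem_orthogonal] at hg
    have hg' : ∀ p, inner ℂ (b p) g = 0 := fun p => hg _ (Submodule.subset_span ⟨p, rfl⟩)
    have hv : ∀ v, ∀ᵐ y ∂(ν v), (g : _ → ℂ) (v, y) = 0 := by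
      intro v
      have hgv : MemLp (fun y => (g : _ → ℂ) (v, y)) 2 (ν v) := by
        have := (Lp.memLp g).restrict (Prod.fst ⁻¹' {v})
        rw [hres, (hemb v).memLp_map_measure_iff] at this
        exact this
      have hz : hgv.toLp _ = 0 := by
        have hd := ContinuousMap.toLp_denseRange ℂ (ν v) ℂ (p := 2) (by norm_num)
        refine hd.eq_zero_of_inner_left (𝕜 := ℂ) ?_
        rintro F
        let Fr : C(spectrum ℝ A, ℝ) := ⟨fun y => (F y).re, by fun_prop⟩
        let Fi : C(spectrum ℝ A, ℝ) := ⟨fun y => (F y).im, by fun_prop⟩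
        have hint : ∀ f : C(spectrum ℝ A, ℝ),
            Integrable (fun y => ((f y : ℝ) : ℂ) * (g : _ → ℂ) (v, y)) (ν v) := by
          intro f
          have h1 : Continuous fun y : spectrum ℝ A => ((f y : ℝ) : ℂ) := by fun_prop
          exact (hgv.integrable (by norm_num)).bdd_mul (c := ‖f‖) h1.aestronglyMeasurable
            (Filter.Eventually.of_forall fun y => by
              rw [Complex.norm_real]; exact f.norm_coe_le_norm y)
        have hr := hg' (v, Fr)
        have hi := hg' (v, Fi)
        rw [hinner] at hr hi
        rw [← inner_conj_symm, L2.inner_def]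
        have : ∫ y, inner ℂ ((ContinuousMap.toLp 2 (ν v) ℂ F : _ → ℂ) y)
            ((hgv.toLp _ : _ → ℂ) y) ∂(ν v) =
            ∫ y, ((Fr y : ℝ) : ℂ) * (g : _ → ℂ) (v, y) ∂(ν v) -
              Complex.I * ∫ y, ((Fi y : ℝ) : ℂ) * (g : _ → ℂ) (v, y) ∂(ν v) := by
          rw [← integral_const_mul, ← integral_sub (hint Fr) ((hint Fi).const_mul _)]
          refine integral_congr_ae ?_
          filter_upwards [ContinuousMap.coeFn_toLp (p := 2) (𝕜 := ℂ) (ν v) F, hgv.coeFn_toLp]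
            with y h1 h2
          rw [h1, h2, RCLike.inner_apply]
          have : (starRingEnd ℂ) (F y) = ((Fr y : ℝ) : ℂ) - Complex.I * ((Fi y : ℝ) : ℂ) := by
            apply Complex.ext <;> simp [Fr, Fi]
          rw [this]; ring
        rw [this]
        dsimp only at hr hi
        rw [hr, hi]
        simp
      have := (Lp.eq_zero_iff_ae_eq_zero.mp hz)
      filter_upwards [this, hgv.coeFn_toLp] with y h1 h2
      rw [← h2, h1]; rfl
    rw [Submodule.mem_bot, Lp.eq_zero_iff_ae_eq_zero]
    refine Measure.ae_sum_iff.mpr fun v => (hemb v).ae_map_iff.mpr ?_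
    exact hv v
  obtain ⟨U, hU⟩ := exists_unitary_of_gram_eq _ b htot hbtot hgram
  refine ⟨μ, U, ?_⟩
  have hbd : ∀ x : V × spectrum ℝ A, ‖((x.2 : ℝ) : ℂ)‖ ≤ ‖A‖ * ‖(1 : H →L[ℂ] H)‖ := by
    intro x
    rw [Complex.norm_real]
    exact spectrum.norm_le_norm_mul_of_mem x.2.2
  have hmeas : Measurable fun x : V × spectrum ℝ A => ((x.2 : ℝ) : ℂ) := by fun_prop
  let M : Lp ℂ 2 μ →L[ℂ] Lp ℂ 2 μ := mulCLM _ hmeas _ hbd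
  have hM : ∀ h, U (A h) = M (U h) := by
    have hd := Submodule.dense_iff_topologicalClosure_eq_top.mpr htot
    have : Set.EqOn (fun h => U (A h)) (fun h => M (U h))
        (Submodule.span ℂ (Set.range fun p : V × C(spectrum ℝ A, ℝ) =>
          cfcHom hA p.2 (e p.1)) : Set H) := by
      intro h hh
      induction hh using Submodule.span_induction with
      | mem x hx =>
        obtain ⟨⟨v, f⟩, rfl⟩ := hx
        have h0 := hU (v, f)
        dsimp only at h0 ⊢
        rw [h0]
        have hid : A = cfcHom hA (ContinuousMap.restrict _ (ContinuousMap.id ℝ)) :=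
          (cfcHom_id hA).symm
        have h1 : A (cfcHom hA f (e v)) =
            cfcHom hA (ContinuousMap.restrict _ (ContinuousMap.id ℝ) * f) (e v) := by
          nth_rw 1 [hid]
          rw [map_mul, mul_apply_eq_comp]
        have h2 := hU (v, ContinuousMap.restrict _ (ContinuousMap.id ℝ) * f)
        dsimp only at h2
        rw [h1, h2]
        refine Lp.ext ?_
        filter_upwards [mulCLM_coeFn _ hmeas _ hbd (b (v, f)), hbc (v, f), hbc (v, _)]
          with x e1 e2 e3
        rw [e1, e2, e3]
        by_cases hxp : x ∈ (Prod.fst ⁻¹' {v} : Set (V × spectrum ℝ A))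
        · simp only [b₀, Set.indicator_of_mem hxp]
          simp
        · simp only [b₀, Set.indicator_of_notMem hxp, mul_zero]
      | zero => simp
      | add x y _ _ hx hy => simp only [map_add] at hx hy ⊢; rw [hx, hy]
      | smul c x _ hx => simp only [map_smul] at hx ⊢; rw [hx]
    exact fun h => congrFun (Continuous.ext_on hd (by fun_prop) (by fun_prop) this) h
  intro h
  rw [hM]
  exact mulCLM_coeFn _ hmeas _ hbd _

end Spectral

-- Splitting a separable space into orthogonal cyclic subspaces.

section Spectral

variable {H : Type*} [NormedAddCommGroup H] [InnerProductSpace ℂ H] [CompleteSpace H]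

/-- The multiplication form of the spectral theorem for a bounded self-adjoint operator on a
separable Hilbert space. -/
theorem exists_multiplication_form {A : H →L[ℂ] H} (hA : IsSelfAdjoint A)
    {V : Type*} [Countable V] [MeasurableSpace V]
    [MeasurableSingletonClass V] (δ : V → H)
    (hδ : (Submodule.span ℂ (Set.range δ)).topologicalClosure = ⊤) :
    ∃ (μ : Measure (V × spectrum ℝ A)) (U : H ≃ₗᵢ[ℂ] Lp ℂ 2 μ), ∀ h : H,
      (U (A h) : V × spectrum ℝ A → ℂ) =ᵐ[μ] fun x => ((x.2 : ℝ) : ℂ) * (U h : _ → ℂ) x := by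
  obtain ⟨enc, henc⟩ := exists_injective_nat V
  let M : ℕ → Submodule ℂ H := fun n => (Submodule.span ℂ
    {x | ∃ v, enc v < n ∧ ∃ f : C(spectrum ℝ A, ℝ), x = cfcHom hA f (δ v)}).topologicalClosure
  have hMmono : Monotone M := fun n m hnm => Submodule.topologicalClosure_mono
    (Submodule.span_mono fun x ⟨v, hv, hx⟩ => ⟨v, hv.trans_le hnm, hx⟩)
  have hMmem : ∀ n v, enc v < n → ∀ f : C(spectrum ℝ A, ℝ),
      cfcHom hA f (δ v) ∈ M n := fun n v hv f =>
    Submodule.le_topologicalClosure _ (Submodule.subset_span ⟨v, hv, f, rfl⟩)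
  have hMinv : ∀ n (f : C(spectrum ℝ A, ℝ)), ∀ x ∈ M n, cfcHom hA f x ∈ M n := by
    intro n f x hx
    refine map_mem_closure (cfcHom hA f).continuous hx fun y hy => ?_
    refine Submodule.span_induction (p := fun y _ => cfcHom hA f y ∈ Submodule.span ℂ _)
      ?_ ?_ ?_ ?_ hy
    · rintro _ ⟨v, hv, g, rfl⟩
      refine Submodule.subset_span ⟨v, hv, f * g, ?_⟩
      rw [map_mul, mul_apply_eq_comp]
    · simp
    · intro x y _ _ hx hy
      rw [map_add]; exact add_mem hx hy
    · intro c x _ hx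
      rw [map_smul]; exact Submodule.smul_mem _ _ hx
  -- Gram–Schmidt with cyclic subspaces in place of vectors. The space `M (enc v)` is invariant
  -- under every `f(A)`, and these are self-adjoint, so orthogonality of `e v` to it passes to the
  -- cyclic subspace of `e v`.
  let e : V → H := fun v => δ v - (M (enc v)).starProjection (δ v)
  have he : ∀ v, e v ∈ (M (enc v))ᗮ := fun v => Submodule.sub_starProjection_mem_orthogonal _
  have heM : ∀ v (f : C(spectrum ℝ A, ℝ)), cfcHom hA f (e v) ∈ M (enc v + 1) := by
    intro v f
    rw [map_sub]
    refine sub_mem (hMmem _ v (Nat.lt_succ_self _) f) (hMmono (Nat.le_succ _) (hMinv _ f _ ?_))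
    exact Submodule.starProjection_apply_mem _ _
  have horth_lt : ∀ v w, enc v < enc w → ∀ f g : C(spectrum ℝ A, ℝ),
      inner ℂ (cfcHom hA f (e v)) (cfcHom hA g (e w)) = 0 := by
    intro v w hvw f g
    have hs : star (cfcHom hA g) = cfcHom hA g := by rw [← map_star, star_trivial]
    rw [← hs, ContinuousLinearMap.star_eq_adjoint, ContinuousLinearMap.adjoint_inner_right]
    exact Submodule.inner_right_of_mem_orthogonal (hMinv _ g _ (hMmono hvw (heM v f))) (he w)
  refine exists_multiplication_form_of_cyclic hA e (fun v w hvw f g => ?_) ?_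
  · rcases lt_or_gt_of_ne (henc.ne hvw) with h | h
    · exact horth_lt v w h f g
    · rw [← inner_conj_symm, horth_lt w v h g f, map_zero]
  · set E := (Submodule.span ℂ (Set.range fun p : V × C(spectrum ℝ A, ℝ) =>
      cfcHom hA p.2 (e p.1))).topologicalClosure with hE
    have hEc : IsClosed (E : Set H) := Submodule.isClosed_topologicalClosure _
    have hME : ∀ n, M n ≤ E := by
      intro n
      induction n with
      | zero =>
        refine Submodule.topologicalClosure_minimal _ (Submodule.span_le.mpr ?_) hEc
        rintro x ⟨v, hv, _⟩
        exact absurd hv (Nat.not_lt_zero _)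
      | succ n ih =>
        refine Submodule.topologicalClosure_minimal _ (Submodule.span_le.mpr ?_) hEc
        rintro x ⟨v, hv, f, rfl⟩
        have hvn : enc v ≤ n := Nat.lt_succ_iff.mp hv
        have h1 : δ v = e v + (M (enc v)).starProjection (δ v) := by simp [e]
        rw [h1, map_add]
        refine add_mem (Submodule.le_topologicalClosure _ (Submodule.subset_span ⟨(v, f), rfl⟩)) ?_
        exact ih (hMmono hvn (hMinv _ f _ (Submodule.starProjection_apply_mem _ _)))
    rw [eq_top_iff, ← hδ]
    refine Submodule.topologicalClosure_minimal _ (Submodule.span_le.mpr ?_) hEc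
    rintro _ ⟨v, rfl⟩
    have := hME _ (hMmem _ v (Nat.lt_succ_self _) 1)
    rwa [map_one] at this

end Spectral

-- From the resolvent to a spectral transform of the Laplacian.

section Graph

variable {V : Type u} (G : SimpleGraph V) [G.LocallyFinite]

/-- Local finiteness leaves finitely many endpoints of walks of each given length from a fixed
vertex. -/
theorem countable_of_connected (hG : G.Connected) : Countable V := by
  obtain ⟨v₀⟩ := hG.nonempty
  have hfin : ∀ n : ℕ, {v | ∃ p : G.Walk v₀ v, p.length = n}.Finite := by
    intro n
    induction n with
    | zero =>
      refine (Set.finite_singleton v₀).subset ?_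
      rintro v ⟨p, hp⟩
      exact (SimpleGraph.Walk.eq_of_length_eq_zero hp).symm
    | succ n ih =>
      refine (ih.biUnion fun w _ => (G.neighborFinset w).finite_toSet).subset ?_
      rintro v ⟨p, hp⟩
      have hnn : ¬ p.Nil := fun h => by
        rw [← SimpleGraph.Walk.length_eq_zero_iff] at h; omega
      simp only [Set.mem_iUnion]
      refine ⟨p.penultimate, ⟨p.dropLast, by simp [hp]⟩, ?_⟩
      simpa using p.adj_penultimate hnn
  have : (Set.univ : Set V) = ⋃ n : ℕ, {v | ∃ p : G.Walk v₀ v, p.length = n} := by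
    ext v
    simp only [Set.mem_univ, Set.mem_iUnion, Set.mem_ofPred_eq, true_iff]
    obtain ⟨p⟩ := hG.preconnected v₀ v
    exact ⟨_, p, rfl⟩
  rw [← Set.countable_univ_iff, this]
  exact Set.countable_iUnion fun n => (hfin n).countable

theorem span_delta : (Submodule.span ℂ (Set.range (delta : V → L2 V))).topologicalClosure = ⊤ := by
  rw [Submodule.topologicalClosure_eq_top_iff, eq_bot_iff]
  intro h hh
  rw [Submodule.mem_orthogonal] at hh
  refine lp.ext (funext fun v => ?_)
  rw [← inner_delta]
  exact hh _ (Submodule.subset_span ⟨v, rfl⟩)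

theorem spectrum_resolv {x : ℝ} (hx : x ∈ spectrum ℝ (resolv G)) : 0 ≤ x ∧ x ≤ 1 := by
  have h0 : 0 ≤ resolv G := (ContinuousLinearMap.nonneg_iff_isPositive _).mpr (isPositive_resolv G)
  refine ⟨spectrum_nonneg_of_nonneg h0 hx, ?_⟩
  have h1 := spectrum.norm_le_norm_mul_of_mem hx
  have h2 : ‖(1 : L2 V →L[ℂ] L2 V)‖ ≤ 1 := ContinuousLinearMap.norm_id_le
  have h3 := norm_resolv_le G
  have h4 : ‖resolv G‖ * ‖(1 : L2 V →L[ℂ] L2 V)‖ ≤ 1 := by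
    have := norm_nonneg (resolv G); have := norm_nonneg (1 : L2 V →L[ℂ] L2 V)
    nlinarith
  exact (le_abs_self x).trans ((Real.norm_eq_abs x ▸ h1).trans h4)

/-- A multiplication form of the resolvent is a spectral Fourier transform of the Laplacian. -/
theorem nonempty_spectralTransform_of_resolv {X : Type*} [MeasurableSpace X] {μ : Measure X}
    (U : L2 V ≃ₗᵢ[ℂ] Lp ℂ 2 μ) (φ : X → ℝ) (hφ : Measurable φ) (h01 : ∀ x, 0 ≤ φ x ∧ φ x ≤ 1)
    (hU : ∀ h : L2 V, (U (resolv G h) : X → ℂ) =ᵐ[μ] fun x => (φ x : ℂ) * (U h : X → ℂ) x) :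
    Nonempty (SpectralTransform G μ) := by
  -- This is `1/φ - 1` where `φ ≠ 0`. Where `φ = 0` the inverse is `0` by convention and nothing is
  -- subtracted, so that `freq = 0`.
  let freq : X → ℝ := fun x => (φ x)⁻¹ - if φ x = 0 then 0 else 1
  have hfm : Measurable freq := by
    refine hφ.inv.sub (Measurable.ite (hφ (measurableSet_singleton 0)) ?_ ?_) <;> fun_prop
  have hf0 : ∀ x, 0 ≤ freq x := by
    intro x
    simp only [freq]
    split_ifs with h
    · simp [h]
    · have hp : 0 < φ x := lt_of_le_of_ne (h01 x).1 (Ne.symm h)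
      have := (one_le_inv₀ hp).mpr (h01 x).2
      linarith
  -- The set `{φ = 0}` carries no vector: the part of `U g` living there is killed by the resolvent,
  -- which is injective.
  have hne : ∀ g : L2 V, ∀ᵐ x ∂μ, φ x = 0 → (U g : _ → ℂ) x = 0 := by
    intro g
    let χ : X → ℂ := fun x => if φ x = 0 then 1 else 0
    have hχ : Measurable χ := Measurable.ite (hφ (measurableSet_singleton 0)) measurable_const
      measurable_const
    have hχ1 : ∀ x, ‖χ x‖ ≤ 1 := fun x => by simp only [χ]; split_ifs <;> simp
    have hz : resolv G (U.symm (mulCLM χ hχ 1 hχ1 (U g))) = 0 := by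
      rw [← U.map_eq_zero_iff, Lp.eq_zero_iff_ae_eq_zero]
      filter_upwards [hU (U.symm (mulCLM χ hχ 1 hχ1 (U g))), mulCLM_coeFn χ hχ 1 hχ1 (U g)]
        with x h1 h2
      rw [h1, LinearIsometryEquiv.apply_symm_apply, h2]
      by_cases h : φ x = 0 <;> simp [χ, h]
    have hz2 : mulCLM χ hχ 1 hχ1 (U g) = 0 := by
      rw [← U.symm.map_eq_zero_iff]
      exact resolv_injective G (hz.trans (map_zero _).symm)
    rw [Lp.eq_zero_iff_ae_eq_zero] at hz2
    filter_upwards [hz2, mulCLM_coeFn χ hχ 1 hχ1 (U g)] with x h1 h2 h3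
    rw [h2] at h1
    simpa [χ, h3] using h1
  have hres : ∀ g : L2 V, (U (g - resolv G g) : _ → ℂ) =ᵐ[μ]
      fun x => (freq x : ℂ) * (U (resolv G g) : _ → ℂ) x := by
    intro g
    rw [map_sub]
    filter_upwards [Lp.coeFn_sub (U g) (U (resolv G g)), hU g, hne g] with x h1 h2 h3
    rw [h1, Pi.sub_apply, h2]
    by_cases h : φ x = 0
    · simp [h3 h, h]
    · have h' : (φ x : ℂ) ≠ 0 := by exact_mod_cast h
      simp only [freq, h, if_false]
      push_cast
      field_simp
  refine ⟨⟨freq, hfm, hf0, U, ?_, ?_⟩⟩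
  · intro f
    constructor
    · intro hf
      have hr := hres (lapPow G 1 f hf + f)
      rw [resolv_lapPow_add] at hr
      exact (memLp_congr_ae hr).mp (Lp.memLp _)
    · intro hf
      -- The vector that should be `(L + 1) f`, assembled on the spectral side.
      let g := U.symm (hf.toLp _) + f
      have hg : resolv G g = f := by
        rw [← U.map_eq_iff]
        refine Lp.ext ?_
        have e0 : U g = hf.toLp _ + U f := by
          rw [map_add, LinearIsometryEquiv.apply_symm_apply]
        filter_upwards [hU g, hf.coeFn_toLp, Lp.coeFn_add (hf.toLp _) (U f), hne f]
          with x h1 h2 h3 h4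
        rw [h1, e0, h3, Pi.add_apply, h2]
        by_cases h : φ x = 0
        · simp [h4 h, h]
        · have h' : (φ x : ℂ) ≠ 0 := by exact_mod_cast h
          simp only [freq, h, if_false]
          push_cast
          field_simp
          ring
      rw [← hg]
      exact resolv_mem G g
  · intro f hf
    have hr := hres (lapPow G 1 f hf + f)
    rw [resolv_lapPow_add, add_sub_cancel_right] at hr
    exact hr

/-- The Laplacian of a connected locally finite graph has a spectral Fourier transform. -/
theorem exists_spectralTransform (hG : G.Connected) :
    ∃ (X : Type u) (_ : MeasurableSpace X) (μ : Measure X), Nonempty (SpectralTransform G μ) := by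
  have := countable_of_connected G hG
  let : MeasurableSpace V := ⊤
  obtain ⟨μ, U, hU⟩ := exists_multiplication_form (isPositive_resolv G).isSelfAdjoint
    (delta : V → L2 V) span_delta
  exact ⟨V × spectrum ℝ (resolv G), inferInstance, μ, nonempty_spectralTransform_of_resolv G U
    (fun x => (x.2 : ℝ)) (by fun_prop) (fun x => spectrum_resolv G x.2.2) hU⟩

end Graph

-- The unitary group, differences, moduli of continuity and Paley-Wiener spaces.

namespace SpectralTransform

variable {V : Type u} {G : SimpleGraph V} [G.LocallyFinite]
  {X : Type w} [MeasurableSpace X] {μ : Measure X} (T : SpectralTransform G μ)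

theorem toIso_expGroup (t : ℝ) (f : L2 V) :
    (T.toIso (T.expGroup t f) : X → ℂ) =ᵐ[μ]
      fun x => Complex.exp (Complex.I * t * T.freq x) * (T.toIso f : X → ℂ) x := by
  rw [expGroup, LinearIsometryEquiv.apply_symm_apply]
  exact MemLp.coeFn_toLp _

theorem norm_exp_freq (t : ℝ) (x : X) : ‖Complex.exp (Complex.I * t * T.freq x)‖ = 1 := by
  have : Complex.I * t * T.freq x = ((t * T.freq x : ℝ) : ℂ) * Complex.I := by
    push_cast; ring
  rw [this, Complex.norm_exp_ofReal_mul_I]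

theorem toIso_sum {ι : Type*} (s : Finset ι) (c : ι → ℂ) (φ : ι → X → ℂ) (g : ι → L2 V) (f : L2 V)
    (h : ∀ i ∈ s, (T.toIso (g i) : X → ℂ) =ᵐ[μ] fun x => φ i x * (T.toIso f : X → ℂ) x) :
    (T.toIso (∑ i ∈ s, c i • g i) : X → ℂ) =ᵐ[μ]
      fun x => (∑ i ∈ s, c i * φ i x) * (T.toIso f : X → ℂ) x := by
  classical
  induction s using Finset.induction_on with
  | empty =>
    simp only [Finset.sum_empty, map_zero, zero_mul]
    exact Lp.coeFn_zero ℂ 2 μ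
  | insert a s ha ih =>
    rw [Finset.sum_insert ha, map_add, map_smul]
    filter_upwards [Lp.coeFn_add (c a • T.toIso (g a)) (T.toIso (∑ i ∈ s, c i • g i)),
      Lp.coeFn_smul (c a) (T.toIso (g a)), h a (Finset.mem_insert_self a s),
      ih fun i hi => h i (Finset.mem_insert_of_mem hi)] with x h1 h2 h3 h4
    rw [h1, Pi.add_apply, h2, Pi.smul_apply, h3, h4, Finset.sum_insert ha, smul_eq_mul]
    ring

theorem toIso_diff (m : ℕ) (s : ℝ) (f : L2 V) :
    (T.toIso (T.diff m s f) : X → ℂ) =ᵐ[μ]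
      fun x => (Complex.exp (Complex.I * s * T.freq x) - 1) ^ m * (T.toIso f : X → ℂ) x := by
  have h := T.toIso_sum (Finset.range (m + 1)) (fun j => (-1 : ℂ) ^ (m + j) * (m.choose j : ℂ))
    (fun j x => Complex.exp (Complex.I * ((j * s : ℝ) : ℂ) * T.freq x))
    (fun j => T.expGroup (j * s) f) f (fun j _ => T.toIso_expGroup _ f)
  filter_upwards [h] with x hx
  rw [diff, hx, sub_eq_add_neg, add_pow]
  congr 1
  refine Finset.sum_congr rfl fun j hj => ?_
  have hj' : j ≤ m := Nat.lt_succ_iff.mp (Finset.mem_range.mp hj)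
  have h1 : Complex.exp (Complex.I * ((j * s : ℝ) : ℂ) * T.freq x) =
      Complex.exp (Complex.I * s * T.freq x) ^ j := by
    rw [← Complex.exp_nat_mul]
    congr 1
    push_cast
    ring
  have h2 : (-1 : ℂ) ^ (m + j) = (-1) ^ (m - j) := by
    obtain ⟨d, rfl⟩ := Nat.exists_eq_add_of_le hj'
    rw [Nat.add_sub_cancel_left, show j + d + j = d + 2 * j by ring, pow_add, pow_mul]
    simp
  rw [h1, h2]
  ring

theorem lapPow_mem_one {k : ℕ} {f : L2 V} (hf : f ∈ lapPowDomain G (k + 1)) :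
    lapPow G k f (fun j hj => hf j (hj.trans (Nat.le_succ k))) ∈ lapPowDomain G 1 := by
  rw [mem_lapPowDomain_one]
  have := hf (k + 1) le_rfl
  rwa [Function.iterate_succ_apply'] at this

theorem toIso_lapPow (k : ℕ) (f : L2 V) (hf : f ∈ lapPowDomain G k) :
    (T.toIso (lapPow G k f hf) : X → ℂ) =ᵐ[μ]
      fun x => (T.freq x : ℂ) ^ k * (T.toIso f : X → ℂ) x := by
  induction k with
  | zero =>
    have : lapPow G 0 f hf = f := rfl
    rw [this]
    filter_upwards with x
    simp
  | succ k ih =>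
    have hk : f ∈ lapPowDomain G k := fun j hj => hf j (hj.trans (Nat.le_succ k))
    have h1 : lapPow G (k + 1) f hf = lapPow G 1 (lapPow G k f hk) (lapPow_mem_one hf) := by
      refine lp.ext ?_
      change (lap G)^[k + 1] _ = lap G ((lap G)^[k] _)
      rw [Function.iterate_succ_apply']
    rw [h1]
    filter_upwards [T.map_lap _ (lapPow_mem_one hf), ih hk] with x h2 h3
    rw [h2, h3]
    ring

theorem norm_le_mul_norm_of_ae {f g : L2 V} {c : ℝ}
    (h : ∀ᵐ x ∂μ, ‖(T.toIso f : X → ℂ) x‖ ≤ c * ‖(T.toIso g : X → ℂ) x‖) : ‖f‖ ≤ c * ‖g‖ := by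
  rw [← T.toIso.norm_map f, ← T.toIso.norm_map g]
  exact Lp.norm_le_mul_norm_of_ae_le_mul h

theorem norm_exp_freq_sub_one_le (τ : ℝ) (x : X) :
    ‖Complex.exp (Complex.I * τ * T.freq x) - 1‖ ≤ |τ| * T.freq x := by
  have : Complex.I * τ * T.freq x = Complex.I * ((τ * T.freq x : ℝ) : ℂ) := by
    push_cast; ring
  rw [this]
  refine Real.norm_exp_I_mul_ofReal_sub_one_le.trans ?_
  rw [Real.norm_eq_abs, abs_mul, abs_of_nonneg (T.freq_nonneg x)]

theorem norm_diff_le_norm_diff_lapPow {k m : ℕ} (hkm : k ≤ m) (τ : ℝ) (f : L2 V)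
    (hf : f ∈ lapPowDomain G k) :
    ‖T.diff m τ f‖ ≤ |τ| ^ k * ‖T.diff (m - k) τ (lapPow G k f hf)‖ := by
  refine T.norm_le_mul_norm_of_ae ?_
  filter_upwards [T.toIso_diff m τ f, T.toIso_diff (m - k) τ (lapPow G k f hf),
    T.toIso_lapPow k f hf] with x h1 h2 h3
  rw [h1, h2, h3]
  simp only [norm_mul, norm_pow, Complex.norm_real, Real.norm_eq_abs,
    abs_of_nonneg (T.freq_nonneg x)]
  set z := ‖Complex.exp (Complex.I * τ * T.freq x) - 1‖ with hz
  have hz1 : z ^ k ≤ (|τ| * T.freq x) ^ k :=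
    pow_le_pow_left₀ (norm_nonneg _) (T.norm_exp_freq_sub_one_le τ x) k
  have e : z ^ m = z ^ k * z ^ (m - k) := by rw [← pow_add, Nat.add_sub_cancel' hkm]
  rw [e, mul_assoc]
  refine (mul_le_mul_of_nonneg_right hz1 (by positivity)).trans_eq ?_
  rw [mul_pow]
  ring

/-- For `|z| = 1`, the factorization of `z^N - 1` as a geometric sum gives `|z^N - 1| ≤ N |z - 1|`.
-/
theorem norm_diff_nat_mul_le (r N : ℕ) (τ : ℝ) (f : L2 V) :
    ‖T.diff r (N * τ) f‖ ≤ (N : ℝ) ^ r * ‖T.diff r τ f‖ := by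
  refine T.norm_le_mul_norm_of_ae ?_
  filter_upwards [T.toIso_diff r (N * τ) f, T.toIso_diff r τ f] with x h1 h2
  rw [h1, h2]
  simp only [norm_mul, norm_pow]
  rw [← mul_assoc, ← mul_pow]
  refine mul_le_mul_of_nonneg_right (pow_le_pow_left₀ (norm_nonneg _) ?_ r) (norm_nonneg _)
  have e : Complex.exp (Complex.I * ((N * τ : ℝ) : ℂ) * T.freq x) =
      Complex.exp (Complex.I * τ * T.freq x) ^ N := by
    rw [← Complex.exp_nat_mul]
    congr 1
    push_cast
    ring
  rw [e, ← geom_sum_mul, norm_mul]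
  refine mul_le_mul_of_nonneg_right ((norm_sum_le _ _).trans ?_) (norm_nonneg _)
  simp [norm_pow, T.norm_exp_freq]

theorem norm_diff_le_two_pow (r : ℕ) (τ : ℝ) (f : L2 V) : ‖T.diff r τ f‖ ≤ 2 ^ r * ‖f‖ := by
  refine T.norm_le_mul_norm_of_ae ?_
  filter_upwards [T.toIso_diff r τ f] with x h1
  rw [h1, norm_mul, norm_pow]
  refine mul_le_mul_of_nonneg_right (pow_le_pow_left₀ (norm_nonneg _) ?_ r) (norm_nonneg _)
  refine (norm_sub_le _ _).trans ?_
  rw [T.norm_exp_freq, norm_one]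
  norm_num

theorem norm_diff_le_modulus (r : ℕ) (f : L2 V) {τ s : ℝ} (h : |τ| ≤ s) :
    ‖T.diff r τ f‖ ≤ T.modulus r f s := by
  refine le_csSup ⟨2 ^ r * ‖f‖, ?_⟩ ⟨τ, h, rfl⟩
  rintro _ ⟨σ, _, rfl⟩
  exact T.norm_diff_le_two_pow r σ f

theorem norm_diff_div_le_modulus (r : ℕ) (f : L2 V) {ω : ℝ} (hω : 0 < ω) (t : ℝ) :
    ‖T.diff r (t / ω) f‖ ≤ (1 + |t|) ^ r * T.modulus r f (1 / ω) := by
  -- An integer with `|t| ≤ N ≤ 1 + |t|`: the step `t/(Nω)` is then admissible in the modulus, at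
  -- the cost of a factor `N^r`.
  set N : ℕ := ⌊|t|⌋₊ + 1 with hN
  have hN0 : (0 : ℝ) < N := by positivity
  have hN1 : |t| ≤ N := by rw [hN]; push_cast; exact (Nat.lt_floor_add_one _).le
  have hN2 : (N : ℝ) ≤ 1 + |t| := by
    rw [hN]; push_cast
    have := Nat.floor_le (abs_nonneg t)
    linarith
  have e : t / ω = N * (t / (N * ω)) := by field_simp
  have h1 : |t / (N * ω)| ≤ 1 / ω := by
    rw [abs_div, abs_of_pos (mul_pos hN0 hω), div_le_div_iff₀ (mul_pos hN0 hω) hω]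
    nlinarith
  have hm := T.norm_diff_le_modulus r f h1
  rw [e]
  refine (T.norm_diff_nat_mul_le r N _ f).trans (mul_le_mul ?_ hm (norm_nonneg _) (by positivity))
  exact pow_le_pow_left₀ hN0.le hN2 r

theorem integrable_conj_mul (g f : L2 V) :
    Integrable (fun x => starRingEnd ℂ ((T.toIso g : X → ℂ) x) * (T.toIso f : X → ℂ) x) μ := by
  have h := L2.integrable_inner (𝕜 := ℂ) (T.toIso g) (T.toIso f)
  refine h.congr (Filter.Eventually.of_forall fun x => ?_)
  simp only [RCLike.inner_apply]
  ring

theorem inner_eq_integral (g f : L2 V) : inner ℂ g f =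
    ∫ x, starRingEnd ℂ ((T.toIso g : X → ℂ) x) * (T.toIso f : X → ℂ) x ∂μ := by
  rw [← T.toIso.inner_map_map, L2.inner_def]
  refine integral_congr_ae (Filter.Eventually.of_forall fun x => ?_)
  simp only [RCLike.inner_apply]
  ring

theorem inner_expGroup (g f : L2 V) (t : ℝ) : inner ℂ g (T.expGroup t f) =
    ∫ x, Complex.exp (Complex.I * t * T.freq x) *
      (starRingEnd ℂ ((T.toIso g : X → ℂ) x) * (T.toIso f : X → ℂ) x) ∂μ := by
  rw [T.inner_eq_integral]
  refine integral_congr_ae ?_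
  filter_upwards [T.toIso_expGroup t f] with x hx
  rw [hx]
  ring

theorem measurable_exp_freq (t : ℝ) :
    Measurable fun x => Complex.exp (Complex.I * t * T.freq x) := by
  have := T.measurable_freq
  fun_prop

theorem continuous_inner_expGroup (g f : L2 V) :
    Continuous fun t => inner ℂ g (T.expGroup t f) := by
  simp only [inner_expGroup]
  refine continuous_of_dominated
    (bound := fun x => ‖starRingEnd ℂ ((T.toIso g : X → ℂ) x) * (T.toIso f : X → ℂ) x‖) ?_ ?_ ?_ ?_
  · intro t
    exact (T.measurable_exp_freq t).aestronglyMeasurable.mul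
      (T.integrable_conj_mul g f).aestronglyMeasurable
  · intro t
    refine Filter.Eventually.of_forall fun x => ?_
    rw [norm_mul, T.norm_exp_freq, one_mul]
  · exact (T.integrable_conj_mul g f).norm
  · exact Filter.Eventually.of_forall fun x => by fun_prop

theorem norm_expGroup (t : ℝ) (f : L2 V) : ‖T.expGroup t f‖ = ‖f‖ := by
  have h : ∀ᵐ x ∂μ, ‖(T.toIso (T.expGroup t f) : X → ℂ) x‖ = ‖(T.toIso f : X → ℂ) x‖ := by
    filter_upwards [T.toIso_expGroup t f] with x hx
    rw [hx, norm_mul, T.norm_exp_freq, one_mul]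
  rw [← T.toIso.norm_map f, ← T.toIso.norm_map (T.expGroup t f), Lp.norm_def, Lp.norm_def,
    eLpNorm_congr_norm_ae h]

/-- Norm preservation upgrades weak continuity to strong continuity. -/
theorem continuous_expGroup (f : L2 V) : Continuous fun t => T.expGroup t f := by
  rw [continuous_iff_continuousAt]
  intro s
  rw [ContinuousAt, tendsto_iff_norm_sub_tendsto_zero]
  have h1 : ∀ t, ‖T.expGroup t f - T.expGroup s f‖ ^ 2 =
      2 * ‖f‖ ^ 2 - 2 * (inner ℂ (T.expGroup s f) (T.expGroup t f)).re := by
    intro t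
    have := @norm_sub_sq ℂ _ _ _ _ (T.expGroup t f) (T.expGroup s f)
    rw [this, norm_expGroup, norm_expGroup, inner_re_symm]
    simp only [RCLike.re_eq_complex_re]
    ring
  have h2 : Continuous fun t => ‖T.expGroup t f - T.expGroup s f‖ ^ 2 := by
    simp only [h1]
    exact continuous_const.sub (continuous_const.mul
      (Complex.continuous_re.comp (T.continuous_inner_expGroup _ f)))
  have h3 := (Real.continuous_sqrt.comp h2).tendsto s
  simpa [Function.comp_def, Real.sqrt_sq] using h3

theorem continuous_diff (m : ℕ) (f : L2 V) : Continuous fun s => T.diff m s f := by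
  have := T.continuous_expGroup f
  unfold diff
  exact continuous_finsetSum _ fun j _ =>
    (continuous_const_smul ((-1 : ℂ) ^ (m + j) * (m.choose j : ℂ))).comp
      (this.comp (by fun_prop : Continuous fun s : ℝ => (j : ℝ) * s))

/-- The test vector is the part of `f` above `ω`; its pairing with `f` is its own squared norm. -/
theorem mem_PW_of_inner {ω : ℝ} {f : L2 V}
    (h : ∀ g : L2 V, (∀ᵐ x ∂μ, T.freq x ≤ ω → (T.toIso g : X → ℂ) x = 0) → inner ℂ g f = 0) :
    f ∈ T.PW ω := by
  classical
  let χ : X → ℂ := fun x => if ω < T.freq x then 1 else 0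
  have hχ : Measurable χ := Measurable.ite
    (measurableSet_lt measurable_const T.measurable_freq) measurable_const measurable_const
  have hχ1 : ∀ x, ‖χ x‖ ≤ 1 := fun x => by simp only [χ]; split_ifs <;> simp
  let g : L2 V := T.toIso.symm (mulCLM χ hχ 1 hχ1 (T.toIso f))
  have hg : (T.toIso g : X → ℂ) =ᵐ[μ] fun x => χ x * (T.toIso f : X → ℂ) x := by
    rw [LinearIsometryEquiv.apply_symm_apply]
    exact mulCLM_coeFn χ hχ 1 hχ1 _
  have h0 : inner ℂ g f = 0 := by
    refine h g ?_
    filter_upwards [hg] with x hx hxω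
    simp [hx, χ, not_lt.mpr hxω]
  have h1 : inner ℂ g g = inner ℂ g f := by
    rw [T.inner_eq_integral, T.inner_eq_integral]
    refine integral_congr_ae ?_
    filter_upwards [hg] with x hx
    rw [hx]
    by_cases hxω : ω < T.freq x <;> simp [χ, hxω]
  rw [h0, inner_self_eq_zero] at h1
  rw [h1, map_zero] at hg
  change ∀ᵐ x ∂μ, _
  filter_upwards [hg, Lp.coeFn_zero ℂ 2 μ] with x h2 h3 h4
  rw [h3] at h2
  simpa [χ, h4] using h2.symm

theorem PW_mem_domain {ω : ℝ} {f : L2 V} (hf : f ∈ T.PW ω) : f ∈ lapPowDomain G 1 := by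
  rw [T.mem_domain_iff]
  have hf' : ∀ᵐ x ∂μ, ω < T.freq x → (T.toIso f : X → ℂ) x = 0 := hf
  refine (Lp.memLp (T.toIso f)).of_le_mul (c := ω) ?_ ?_
  · exact (Complex.measurable_ofReal.comp T.measurable_freq).aestronglyMeasurable.mul
      (Lp.aestronglyMeasurable _)
  · filter_upwards [hf'] with x hx
    rw [norm_mul, Complex.norm_real, Real.norm_eq_abs, abs_of_nonneg (T.freq_nonneg x)]
    by_cases h : ω < T.freq x
    · simp [hx h]
    · exact mul_le_mul_of_nonneg_right (not_lt.mp h) (norm_nonneg _)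

/-- The Bernstein inequality. -/
theorem norm_lap_le_of_mem_PW {ω : ℝ} {f : L2 V} (hf : f ∈ T.PW ω) (hf1 : f ∈ lapPowDomain G 1) :
    ‖lapPow G 1 f hf1‖ ≤ ω * ‖f‖ := by
  have hf' : ∀ᵐ x ∂μ, ω < T.freq x → (T.toIso f : X → ℂ) x = 0 := hf
  refine T.norm_le_mul_norm_of_ae ?_
  filter_upwards [hf', T.map_lap f hf1] with x hx h1
  rw [h1, norm_mul, Complex.norm_real, Real.norm_eq_abs, abs_of_nonneg (T.freq_nonneg x)]
  by_cases h : ω < T.freq x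
  · simp [hx h]
  · exact mul_le_mul_of_nonneg_right (not_lt.mp h) (norm_nonneg _)

end SpectralTransform

-- The kernel: decay, normalization and band limitation.

section Kernel

theorem abs_sinc_mul_le (t : ℝ) : (1 + |t|) * |Real.sinc t| ≤ 2 := by
  have h1 := Real.abs_sinc_le_one t
  have h2 : |t| * |Real.sinc t| ≤ 1 := by
    rw [← abs_mul]
    by_cases ht : t = 0
    · simp [ht]
    · rw [Real.sinc_of_ne_zero ht, mul_div_cancel₀ _ ht]
      exact Real.abs_sin_le_one t
  linarith

/-- Each factor `(1 + |t|) |sinc t|` is at most `2`; two spare powers pay for `1 + t²`. -/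
theorem one_add_abs_pow_mul_abs_sinc_pow_le {m n : ℕ} (h : m + 2 ≤ n) (t : ℝ) :
    (1 + |t|) ^ m * |Real.sinc t| ^ n ≤ 2 ^ n * (1 + t ^ 2)⁻¹ := by
  have h0 := abs_nonneg t
  have hp : (0 : ℝ) < 1 + t ^ 2 := by positivity
  rw [← div_eq_mul_inv, le_div_iff₀ hp]
  have h1 : 1 + t ^ 2 ≤ (1 + |t|) ^ 2 := by
    rw [← sq_abs t]; nlinarith
  calc (1 + |t|) ^ m * |Real.sinc t| ^ n * (1 + t ^ 2)
      ≤ (1 + |t|) ^ m * |Real.sinc t| ^ n * (1 + |t|) ^ 2 :=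
        mul_le_mul_of_nonneg_left h1 (by positivity)
    _ = (1 + |t|) ^ (m + 2) * |Real.sinc t| ^ n := by ring
    _ ≤ (1 + |t|) ^ n * |Real.sinc t| ^ n := by
        refine mul_le_mul_of_nonneg_right ?_ (by positivity)
        exact pow_le_pow_right₀ (by linarith) h
    _ = ((1 + |t|) * |Real.sinc t|) ^ n := by rw [mul_pow]
    _ ≤ 2 ^ n := pow_le_pow_left₀ (by positivity) (abs_sinc_mul_le t) n

theorem integrable_one_add_abs_pow_mul_sinc_pow {m n : ℕ} (h : m + 2 ≤ n) :
    Integrable fun t : ℝ => (1 + |t|) ^ m * Real.sinc t ^ n := by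
  refine (integrable_inv_one_add_sq.const_mul (2 ^ n)).mono' ?_ ?_
  · have := Real.continuous_sinc
    exact Continuous.aestronglyMeasurable (by fun_prop)
  · refine Filter.Eventually.of_forall fun t => ?_
    rw [norm_mul, norm_pow, norm_pow, Real.norm_eq_abs, Real.norm_eq_abs,
      abs_of_nonneg (by positivity : 0 ≤ 1 + |t|)]
    exact one_add_abs_pow_mul_abs_sinc_pow_le h t

theorem integrable_sinc_pow {n : ℕ} (hn : 2 ≤ n) : Integrable fun t : ℝ => Real.sinc t ^ n := by
  simpa using integrable_one_add_abs_pow_mul_sinc_pow (m := 0) hn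

theorem intervalIntegral_exp_eq_sinc (t : ℝ) :
    ∫ x in (-1 : ℝ)..1, Complex.exp (Complex.I * t * x) = 2 * (Real.sinc t : ℂ) := by
  by_cases ht : t = 0
  · simp [ht]; norm_num
  · have htc : (t : ℂ) ≠ 0 := by exact_mod_cast ht
    have hc : Complex.I * t ≠ 0 := mul_ne_zero Complex.I_ne_zero htc
    rw [integral_exp_mul_complex hc, Real.sinc_of_ne_zero ht]
    push_cast
    have := Complex.two_sin (t : ℂ)
    rw [mul_one, mul_neg_one, div_eq_iff hc]
    rw [mul_comm Complex.I (t : ℂ)]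
    rw [neg_mul] at this
    field_simp
    linear_combination (-Complex.I) * this + (Complex.exp (t * Complex.I) -
      Complex.exp (-(t * Complex.I))) * Complex.I_sq

open scoped FourierTransform Convolution in
-- Up to scaling, `sinc²` is the Fourier transform of the indicator of an interval of length `2`
-- convolved with itself, which vanishes beyond distance `2`. Fourier inversion at `s` gives the
-- claim.
theorem integral_sinc_sq_mul_exp {s : ℝ} (hs : 2 < |s|) :
    ∫ t : ℝ, ((Real.sinc t ^ 2 : ℝ) : ℂ) * Complex.exp (Complex.I * t * s) = 0 := by
  let b : ℝ → ℂ := (Set.Ioc (-1 : ℝ) 1).indicator fun _ => 1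
  have hbi : Integrable b := (integrable_indicator_iff measurableSet_Ioc).mpr
    (integrableOn_const (by simp))
  have hFb : ∀ ξ : ℝ, 𝓕 b ξ = 2 * (Real.sinc (2 * Real.pi * ξ) : ℂ) := by
    intro ξ
    rw [Real.fourier_real_eq_integral_exp_smul, ← Real.sinc_neg, ← intervalIntegral_exp_eq_sinc,
      intervalIntegral.integral_of_le (by norm_num), ← integral_indicator measurableSet_Ioc]
    refine integral_congr_ae (Filter.Eventually.of_forall fun x => ?_)
    by_cases hx : x ∈ Set.Ioc (-1 : ℝ) 1
    · simp only [b, Set.indicator_of_mem hx, smul_eq_mul, mul_one]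
      congr 1
      push_cast
      ring
    · simp only [b, Set.indicator_of_notMem hx, smul_zero]
  let g : ℝ → ℂ := b ⋆[ContinuousLinearMap.mul ℂ ℂ] b
  have hgi : Integrable g := hbi.integrable_convolution _ hbi
  have hFg : ∀ ξ : ℝ, 𝓕 g ξ = 4 * ((Real.sinc (2 * Real.pi * ξ) ^ 2 : ℝ) : ℂ) := by
    intro ξ
    rw [Real.fourier_mul_convolution_eq hbi hbi, hFb]
    push_cast
    ring
  have hFgi : Integrable (𝓕 g) := by
    have : 𝓕 g = fun ξ => 4 * ((Real.sinc (2 * Real.pi * ξ) ^ 2 : ℝ) : ℂ) := funext hFg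
    rw [this]
    have h1 := (integrable_sinc_pow le_rfl).comp_mul_left' (by positivity : 2 * Real.pi ≠ 0)
    exact h1.ofReal.const_mul _
  have hg0 : ∀ x : ℝ, 2 < |x| → g x = 0 := by
    intro x hx
    change ∫ t, _ ∂_ = _
    refine integral_eq_zero_of_ae (Filter.Eventually.of_forall fun t => ?_)
    simp only [ContinuousLinearMap.mul_apply', Pi.zero_apply, b, Set.indicator_apply, Set.mem_Ioc]
    rcases lt_abs.mp hx with h | h
    · split_ifs with h1 h2 <;> simp
      linarith [h1.2, h2.2]
    · split_ifs with h1 h2 <;> simp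
      linarith [h1.1, h2.1]
  have hev : ∀ᶠ x in nhds s, g x = 0 := by
    filter_upwards [(continuous_abs.tendsto s).eventually (lt_mem_nhds hs)] with x hx
    exact hg0 x hx
  -- Inversion only needs continuity at `s`, and `g` is zero near `s`.
  have hcont : ContinuousAt g s :=
    (continuousAt_const (y := (0 : ℂ))).congr (hev.mono fun x hx => hx.symm)
  have hinv := hgi.fourierInv_fourier_eq hFgi hcont
  rw [hg0 s hs, Real.fourierInv_eq' , ← mul_zero (4 : ℂ)] at hinv
  have hsub := Measure.integral_comp_mul_left
    (fun t : ℝ => ((Real.sinc t ^ 2 : ℝ) : ℂ) * Complex.exp (Complex.I * t * s)) (2 * Real.pi)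
  have h2 : ∫ ξ : ℝ, ((Real.sinc (2 * Real.pi * ξ) ^ 2 : ℝ) : ℂ) *
      Complex.exp (Complex.I * ((2 * Real.pi * ξ : ℝ) : ℂ) * s) = 0 := by
    have h4 : (4 : ℂ) * ∫ ξ : ℝ, ((Real.sinc (2 * Real.pi * ξ) ^ 2 : ℝ) : ℂ) *
      Complex.exp (Complex.I * ((2 * Real.pi * ξ : ℝ) : ℂ) * s) = 4 * 0 := by
      rw [← hinv, ← integral_const_mul]
      refine integral_congr_ae (Filter.Eventually.of_forall fun ξ => ?_)
      simp only [hFg, smul_eq_mul]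
      have : (Complex.I * ((2 * Real.pi * ξ : ℝ) : ℂ) * s) =
          ((2 * Real.pi * inner ℝ ξ s : ℝ) : ℂ) * Complex.I := by
        simp only [RCLike.inner_apply, conj_trivial]
        push_cast
        ring
      rw [this]
      ring
    exact mul_left_cancel₀ (by norm_num) h4
  rw [h2] at hsub
  have hpos : |(2 * Real.pi)⁻¹| ≠ 0 := by positivity
  exact (smul_eq_zero.mp hsub.symm).resolve_left hpos

/-- Since `2 sinc t = ∫_{-1}^1 e^{itx} dx`, one more factor averages over frequency shifts of size
at most `1`. The induction starts at `2` because `sinc` itself is not integrable. -/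
theorem integral_sinc_pow_mul_exp {n : ℕ} (hn : 2 ≤ n) :
    ∀ {s : ℝ}, (n : ℝ) < |s| →
      ∫ t : ℝ, ((Real.sinc t ^ n : ℝ) : ℂ) * Complex.exp (Complex.I * t * s) = 0 := by
  induction n, hn using Nat.le_induction with
  | base => exact fun hs => integral_sinc_sq_mul_exp (by exact_mod_cast hs)
  | succ n hn ih =>
    intro s hs
    push_cast at hs
    have h1 : ∀ t : ℝ, 2 * (((Real.sinc t ^ (n + 1) : ℝ) : ℂ) * Complex.exp (Complex.I * t * s)) =
        ∫ x in Set.Ioc (-1 : ℝ) 1, ((Real.sinc t ^ n : ℝ) : ℂ) *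
          Complex.exp (Complex.I * t * ((s + x : ℝ) : ℂ)) := by
      intro t
      have := intervalIntegral_exp_eq_sinc t
      rw [intervalIntegral.integral_of_le (by norm_num)] at this
      have e : ∀ x : ℝ, ((Real.sinc t ^ n : ℝ) : ℂ) *
          Complex.exp (Complex.I * t * ((s + x : ℝ) : ℂ)) = (((Real.sinc t ^ n : ℝ) : ℂ) *
          Complex.exp (Complex.I * t * s)) * Complex.exp (Complex.I * t * x) := by
        intro x
        rw [mul_assoc _ (Complex.exp _), ← Complex.exp_add]
        congr 2
        push_cast
        ring
      simp only [e]
      rw [integral_const_mul, this]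
      push_cast
      ring
    have h2 : (2 : ℂ) * ∫ t : ℝ, ((Real.sinc t ^ (n + 1) : ℝ) : ℂ) *
        Complex.exp (Complex.I * t * s) = 0 := by
      rw [← integral_const_mul]
      simp only [h1]
      rw [integral_integral_swap]
      · refine integral_eq_zero_of_ae ?_
        filter_upwards [ae_restrict_mem measurableSet_Ioc] with x hx
        refine ih ?_
        have hx1 : |x| ≤ 1 := abs_le.mpr ⟨hx.1.le, hx.2⟩
        have h3 : |s| ≤ |s + x| + |x| := by
          simpa using abs_sub (s + x) x
        linarith
      · have hi : Integrable (fun t : ℝ => ((Real.sinc t ^ n : ℝ) : ℂ)) :=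
          (integrable_sinc_pow hn).ofReal
        have hi2 : Integrable (fun p : ℝ × ℝ => ((Real.sinc p.1 ^ n : ℝ) : ℂ) * 1)
            (volume.prod (volume.restrict (Set.Ioc (-1 : ℝ) 1))) :=
          Integrable.mul_prod hi (integrable_const 1)
        refine hi2.mono ?_ ?_
        · have := Real.continuous_sinc
          refine Continuous.aestronglyMeasurable ?_
          unfold Function.uncurry
          fun_prop
        · refine Filter.Eventually.of_forall fun p => le_of_eq ?_
          have : Complex.I * (p.1 : ℂ) * ((s + p.2 : ℝ) : ℂ) =
              ((p.1 * (s + p.2) : ℝ) : ℂ) * Complex.I := by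
            push_cast; ring
          simp only [Function.uncurry, norm_mul, this, Complex.norm_exp_ofReal_mul_I, norm_one]
    exact (mul_eq_zero.mp h2).resolve_left two_ne_zero

/-- The normalization constant of the kernel. -/
def kernelConst (n : ℕ) : ℝ := (∫ s : ℝ, (Real.sin (s / n) / s) ^ n)⁻¹ * ((n : ℝ)⁻¹) ^ n

theorem sin_div_ae {n : ℕ} (hn : n ≠ 0) : (fun t : ℝ => (Real.sin (t / n) / t) ^ n) =ᵐ[volume]
    fun t => ((n : ℝ)⁻¹) ^ n * Real.sinc (t / n) ^ n := by
  filter_upwards [compl_mem_ae_iff.mpr (measure_singleton (0 : ℝ))] with t ht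
  have ht0 : t ≠ 0 := ht
  have hn0 : (n : ℝ) ≠ 0 := by exact_mod_cast hn
  rw [Real.sinc_of_ne_zero (div_ne_zero ht0 hn0), ← mul_pow]
  congr 1
  field_simp

theorem kernel_ae {n : ℕ} (hn : n ≠ 0) : kernel n =ᵐ[volume]
    fun t => kernelConst n * Real.sinc (t / n) ^ n := by
  filter_upwards [sin_div_ae hn] with t ht
  rw [kernel, ht, kernelConst]
  ring

theorem integrable_kernel_mul {m n : ℕ} (h : m + 2 ≤ n) :
    Integrable fun t : ℝ => |kernel n t| * (1 + |t|) ^ m := by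
  have hn : n ≠ 0 := by omega
  have hn1 : (1 : ℝ) ≤ n := by exact_mod_cast Nat.one_le_iff_ne_zero.mpr hn
  have hn0 : (0 : ℝ) < n := by linarith
  have h1 : Integrable fun t : ℝ => (1 + |t / n|) ^ m * Real.sinc (t / n) ^ n :=
    (integrable_one_add_abs_pow_mul_sinc_pow h).comp_div hn0.ne'
  have h2 := h1.const_mul (|kernelConst n| * (n : ℝ) ^ m)
  refine h2.mono ?_ ?_
  · have hk : AEStronglyMeasurable (kernel n) volume := by
      have := Real.continuous_sinc
      refine AEStronglyMeasurable.congr (Continuous.aestronglyMeasurable ?_) (kernel_ae hn).symm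
      fun_prop
    exact hk.norm.mul (Continuous.aestronglyMeasurable (by fun_prop))
  · filter_upwards [kernel_ae hn] with t ht
    rw [ht]
    simp only [norm_mul, norm_pow, Real.norm_eq_abs, abs_abs, abs_mul, abs_pow, Nat.abs_cast]
    have e1 : abs (1 + |t|) = 1 + |t| := abs_of_nonneg (by positivity)
    have e2 : abs (1 + |t / n|) = 1 + |t / n| := abs_of_nonneg (by positivity)
    rw [e1, e2]
    have h3 : 1 + |t| ≤ n * (1 + |t / n|) := by
      rw [abs_div, Nat.abs_cast, mul_add, mul_div_cancel₀ _ hn0.ne']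
      linarith
    have h4 := pow_le_pow_left₀ (by positivity) h3 m
    rw [mul_pow] at h4
    calc _ ≤ |kernelConst n| * |Real.sinc (t / n)| ^ n * ((n : ℝ) ^ m * (1 + |t / n|) ^ m) :=
          mul_le_mul_of_nonneg_left h4 (by positivity)
      _ = _ := by ring

theorem integrable_kernel {n : ℕ} (hn : 2 ≤ n) : Integrable (kernel n) := by
  have h := integrable_kernel_mul (m := 0) hn
  simp only [pow_zero, mul_one] at h
  have hk : AEStronglyMeasurable (kernel n) volume := by
    have := Real.continuous_sinc
    refine AEStronglyMeasurable.congr (Continuous.aestronglyMeasurable ?_)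
      (kernel_ae (by omega)).symm
    fun_prop
  exact (integrable_norm_iff hk).mp h

/-- For even `n` the integrand is nonnegative, so the normalizing integral is positive and its
inverse is genuine. -/
theorem integral_kernel {n : ℕ} (hn : 2 ≤ n) (he : Even n) : ∫ t, kernel n t = 1 := by
  have hn0 : (n : ℝ) ≠ 0 := by exact_mod_cast (by omega : n ≠ 0)
  have hpos : 0 < ∫ s : ℝ, (Real.sin (s / n) / s) ^ n := by
    rw [integral_congr_ae (sin_div_ae (by omega))]
    have hc : Continuous fun t : ℝ => ((n : ℝ)⁻¹) ^ n * Real.sinc (t / n) ^ n := by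
      have := Real.continuous_sinc
      fun_prop
    refine integral_pos_of_integrable_nonneg_nonzero (x := 0) hc
      (((integrable_sinc_pow hn).comp_div hn0).const_mul _) (fun t => ?_) ?_
    · exact mul_nonneg (by positivity) (he.pow_nonneg _)
    · simp [hn0]
  simp only [kernel]
  rw [integral_const_mul, inv_mul_cancel₀ hpos.ne']

theorem integral_kernel_mul_exp {n : ℕ} (hn : 2 ≤ n) {s : ℝ} (hs : 1 < |s|) :
    ∫ t : ℝ, (kernel n t : ℂ) * Complex.exp (Complex.I * t * s) = 0 := by
  have hn0 : (0 : ℝ) < n := by exact_mod_cast (by omega : 0 < n)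
  have h1 : (n : ℝ) < |n * s| := by
    rw [abs_mul, Nat.abs_cast]
    nlinarith
  have h2 := integral_sinc_pow_mul_exp hn h1
  have h3 := Measure.integral_comp_div
    (fun t : ℝ => ((Real.sinc t ^ n : ℝ) : ℂ) * Complex.exp (Complex.I * t * ((n * s : ℝ) : ℂ))) n
  rw [h2, smul_zero] at h3
  have h4 : ∫ t : ℝ, (kernel n t : ℂ) * Complex.exp (Complex.I * t * s) =
      ∫ t : ℝ, (kernelConst n : ℂ) * (((Real.sinc (t / n) ^ n : ℝ) : ℂ) *
        Complex.exp (Complex.I * ((t / n : ℝ) : ℂ) * ((n * s : ℝ) : ℂ))) := by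
    refine integral_congr_ae ?_
    filter_upwards [kernel_ae (by omega : n ≠ 0)] with t ht
    have hnc : (n : ℂ) ≠ 0 := by exact_mod_cast hn0.ne'
    have e : Complex.I * ((t / n : ℝ) : ℂ) * ((n * s : ℝ) : ℂ) = Complex.I * t * s := by
      push_cast
      field_simp
    rw [ht, e]
    push_cast
    ring
  rw [h4, integral_const_mul, h3, mul_zero]

end Kernel

-- The filtering operator: approximation error and band limitation.

namespace SpectralTransform

variable {V : Type u} {G : SimpleGraph V} [G.LocallyFinite]
  {X : Type w} [MeasurableSpace X] {μ : Measure X} (T : SpectralTransform G μ)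

theorem integrable_kernel_smul {n : ℕ} (hn : 2 ≤ n) {F : ℝ → L2 V} (hF : Continuous F) (C : ℝ)
    (hC : ∀ t, ‖F t‖ ≤ C) : Integrable fun t => (kernel n t : ℂ) • F t := by
  have hk : Integrable fun t => (kernel n t : ℂ) := (integrable_kernel hn).ofReal
  refine (hk.norm.mul_const C).mono' (hk.aestronglyMeasurable.smul hF.aestronglyMeasurable)
    (Filter.Eventually.of_forall fun t => ?_)
  rw [norm_smul]
  exact mul_le_mul_of_nonneg_left (hC t) (norm_nonneg _)

theorem integrable_kernel_smul_diff {n : ℕ} (hn : 2 ≤ n) (m : ℕ) (ω : ℝ) (f : L2 V) :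
    Integrable fun t => (kernel n t : ℂ) • T.diff m (t / ω) f :=
  integrable_kernel_smul hn ((T.continuous_diff m f).comp (by fun_prop)) _
    fun t => T.norm_diff_le_two_pow m (t / ω) f

theorem integrable_filterIntegrand {n : ℕ} (hn : 2 ≤ n) (m : ℕ) (ω : ℝ) (f : L2 V) :
    Integrable (T.filterIntegrand n m ω f) := by
  have h1 : Integrable fun t => (-1 : ℂ) ^ (m + 1) • ((kernel n t : ℂ) • T.diff m (t / ω) f) :=
    (T.integrable_kernel_smul_diff hn m ω f).smul ((-1 : ℂ) ^ (m + 1))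
  have h2 : Integrable fun t => (kernel n t : ℂ) • f := (integrable_kernel hn).ofReal.smul_const f
  refine (h1.add h2).congr (Filter.Eventually.of_forall fun t => ?_)
  simp only [Pi.add_apply, filterIntegrand, smul_add]
  rw [smul_comm]

theorem sub_filterOp {n : ℕ} (hn : 2 ≤ n) (he : Even n) (m : ℕ) (ω : ℝ) (f : L2 V) :
    f - T.filterOp n m ω f = (-1 : ℂ) ^ m • ∫ t, (kernel n t : ℂ) • T.diff m (t / ω) f := by
  have h1 : Integrable fun t => (-1 : ℂ) ^ (m + 1) • ((kernel n t : ℂ) • T.diff m (t / ω) f) :=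
    (T.integrable_kernel_smul_diff hn m ω f).smul ((-1 : ℂ) ^ (m + 1))
  have h2 : Integrable fun t => (kernel n t : ℂ) • f := (integrable_kernel hn).ofReal.smul_const f
  have e : T.filterIntegrand n m ω f = fun t => (-1 : ℂ) ^ (m + 1) •
      ((kernel n t : ℂ) • T.diff m (t / ω) f) + (kernel n t : ℂ) • f := by
    funext t
    rw [filterIntegrand, smul_add, smul_comm]
  have h3 : ∫ t, (kernel n t : ℂ) • f = f := by
    rw [integral_smul_const, integral_complex_ofReal, integral_kernel hn he, Complex.ofReal_one,
      one_smul]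
  rw [filterOp, e, integral_add h1 h2, h3, integral_smul, pow_succ]
  module

theorem norm_sub_filterOp_le {n m k : ℕ} (hn : m + 2 ≤ n) (he : Even n) (hkm : k ≤ m) {ω : ℝ}
    (hω : 0 < ω) (f : L2 V) (hf : f ∈ lapPowDomain G k) :
    ‖f - T.filterOp n m ω f‖ ≤ (∫ t, |kernel n t| * (1 + |t|) ^ m) / ω ^ k *
      T.modulus (m - k) (lapPow G k f hf) (1 / ω) := by
  set Ω := T.modulus (m - k) (lapPow G k f hf) (1 / ω) with hΩ
  have hΩ0 : 0 ≤ Ω := (norm_nonneg _).trans (T.norm_diff_le_modulus (τ := 0) (m - k)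
    (lapPow G k f hf) (by simpa using hω.le))
  rw [T.sub_filterOp (by omega) he, norm_smul, norm_pow, norm_neg, norm_one, one_pow, one_mul]
  have hb : ∀ t : ℝ, ‖(kernel n t : ℂ) • T.diff m (t / ω) f‖ ≤
      |kernel n t| * (1 + |t|) ^ m * (Ω / ω ^ k) := by
    intro t
    rw [norm_smul, Complex.norm_real, Real.norm_eq_abs, mul_assoc]
    refine mul_le_mul_of_nonneg_left ?_ (abs_nonneg _)
    have h1 := T.norm_diff_le_norm_diff_lapPow hkm (t / ω) f hf
    have h2 := T.norm_diff_div_le_modulus (m - k) (lapPow G k f hf) hω t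
    -- Enlarging `|t|^k` to `(1 + |t|)^k` lets the two weights combine into `(1 + |t|)^m`, whatever
    -- `k` is.
    have h3 : |t / ω| ^ k ≤ (1 + |t|) ^ k / ω ^ k := by
      rw [abs_div, abs_of_pos hω, div_pow]
      gcongr
      linarith
    calc ‖T.diff m (t / ω) f‖ ≤ (1 + |t|) ^ k / ω ^ k * ((1 + |t|) ^ (m - k) * Ω) :=
          h1.trans (mul_le_mul h3 h2 (norm_nonneg _) (by positivity))
      _ = ((1 + |t|) ^ k * (1 + |t|) ^ (m - k)) * (Ω / ω ^ k) := by ring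
      _ = (1 + |t|) ^ m * (Ω / ω ^ k) := by rw [← pow_add, Nat.add_sub_cancel' hkm]
  refine (norm_integral_le_of_norm_le ((integrable_kernel_mul hn).mul_const _)
    (Filter.Eventually.of_forall hb)).trans_eq ?_
  rw [integral_mul_const]
  ring

theorem integral_kernel_mul_integral_exp {n j : ℕ} (hn : 2 ≤ n) (hj : 1 ≤ j) {ω : ℝ} (hω : 0 < ω)
    {g f : L2 V} (hg : ∀ᵐ x ∂μ, T.freq x ≤ ω → (T.toIso g : X → ℂ) x = 0) :
    ∫ t : ℝ, (kernel n t : ℂ) * inner ℂ g (T.expGroup (j * (t / ω)) f) = 0 := by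
  simp only [T.inner_expGroup]
  set w : X → ℂ := fun x => starRingEnd ℂ ((T.toIso g : X → ℂ) x) * (T.toIso f : X → ℂ) x with hw
  have hwi : Integrable w μ := T.integrable_conj_mul g f
  have hw0 : ∀ᵐ x ∂μ, T.freq x ≤ ω → w x = 0 := by
    filter_upwards [hg] with x hx h
    simp [hw, hx h]
  -- The measure `μ` need not be σ-finite, as Fubini requires; the integrable `w` is supported on a
  -- σ-finite set, to which the integral is restricted.
  have hfin : AEFinStronglyMeasurable w μ := hwi.aefinStronglyMeasurable
  set s := hfin.sigmaFiniteSet with hs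
  have hsc : ∀ᵐ x ∂μ, x ∉ s → w x = 0 :=
    (ae_restrict_iff' hfin.measurableSet.compl).mp hfin.ae_eq_zero_compl
  have hsf : SigmaFinite (μ.restrict s) := hfin.sigmaFinite_restrict
  have h1 : ∀ t : ℝ, (kernel n t : ℂ) *
      ∫ x, Complex.exp (Complex.I * ((j * (t / ω) : ℝ) : ℂ) * T.freq x) * w x ∂μ =
      ∫ x in s, ((kernel n t : ℂ) * w x) *
        Complex.exp (Complex.I * ((j * (t / ω) : ℝ) : ℂ) * T.freq x) ∂μ := by
    intro t
    rw [← setIntegral_eq_integral_of_ae_compl_eq_zero (s := s), ← integral_const_mul]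
    · refine integral_congr_ae (Filter.Eventually.of_forall fun x => ?_)
      simp only
      ring
    · filter_upwards [hsc] with x hx hxs
      rw [hx hxs, mul_zero]
  refine (integral_congr_ae (Filter.Eventually.of_forall h1)).trans ?_
  have hfm := T.measurable_freq
  rw [integral_integral_swap]
  · refine integral_eq_zero_of_ae ?_
    filter_upwards [ae_restrict_of_ae hw0] with x hx
    by_cases h : T.freq x ≤ ω
    · simp [hx h]
    · have hlt : 1 < |(j : ℝ) * T.freq x / ω| := by
        have hj' : (1 : ℝ) ≤ j := by exact_mod_cast hj
        refine lt_of_lt_of_le ?_ (le_abs_self _)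
        rw [lt_div_iff₀ hω]
        nlinarith [not_le.mp h]
      have h2 := integral_kernel_mul_exp hn hlt
      have h3 : ∀ t : ℝ, ((kernel n t : ℂ) * w x) *
          Complex.exp (Complex.I * ((j * (t / ω) : ℝ) : ℂ) * T.freq x) = w x *
          ((kernel n t : ℂ) *
            Complex.exp (Complex.I * t * (((j : ℝ) * T.freq x / ω : ℝ) : ℂ))) := by
        intro t
        have : Complex.I * ((j * (t / ω) : ℝ) : ℂ) * T.freq x =
            Complex.I * t * (((j : ℝ) * T.freq x / ω : ℝ) : ℂ) := by
          push_cast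
          ring
        rw [this]
        ring
      simp only [h3]
      rw [integral_const_mul, h2, mul_zero]
      rfl
  · have hi : Integrable (fun p : ℝ × X => (kernel n p.1 : ℂ) * w p.2)
        (volume.prod (μ.restrict s)) :=
      Integrable.mul_prod (integrable_kernel hn).ofReal hwi.restrict
    refine hi.mono ?_ ?_
    · refine hi.aestronglyMeasurable.mul (Measurable.aestronglyMeasurable ?_)
      fun_prop
    · refine Filter.Eventually.of_forall fun p => le_of_eq ?_
      simp only [Function.uncurry, norm_mul]
      rw [T.norm_exp_freq, mul_one]

theorem filterOp_mem_PW {n : ℕ} (hn : 2 ≤ n) (m : ℕ) {ω : ℝ} (hω : 0 < ω) (f : L2 V) :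
    T.filterOp n m ω f ∈ T.PW ω := by
  refine T.mem_PW_of_inner fun g hg => ?_
  rw [filterOp, ← integral_inner (T.integrable_filterIntegrand hn m ω f)]
  have h0 : T.expGroup 0 f = f := by
    rw [← T.toIso.map_eq_iff]
    refine Lp.ext ?_
    filter_upwards [T.toIso_expGroup 0 f] with x hx
    rw [hx]
    simp
  have h1 : ∀ t : ℝ, inner ℂ g (T.filterIntegrand n m ω f t) =
      ∑ j ∈ Finset.range m, ((-1 : ℂ) ^ (m + 1) * ((-1 : ℂ) ^ (m + (j + 1)) *
        (m.choose (j + 1) : ℂ))) * ((kernel n t : ℂ) *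
          inner ℂ g (T.expGroup ((j + 1 : ℕ) * (t / ω)) f)) := by
    intro t
    rw [filterIntegrand, diff, Finset.sum_range_succ']
    simp only [Nat.cast_zero, zero_mul, h0, add_zero, Nat.choose_zero_right, Nat.cast_one, mul_one]
    -- The sign by which the `j = 0` term of the difference cancels the summand `f`.
    have h2 : (-1 : ℂ) ^ (m + 1) * (-1) ^ m = -1 := by
      rw [← pow_add, show m + 1 + m = 2 * m + 1 by ring, pow_succ, pow_mul]
      simp
    simp only [inner_smul_right, inner_add_right, inner_sum, Finset.mul_sum, mul_add]
    rw [add_assoc]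
    have h3 : (kernel n t : ℂ) * ((-1) ^ (m + 1) * ((-1) ^ m * inner ℂ g f)) +
        (kernel n t : ℂ) * inner ℂ g f = 0 := by
      linear_combination ((kernel n t : ℂ) * inner ℂ g f) * h2
    rw [h3, add_zero]
    exact Finset.sum_congr rfl fun j _ => by ring
  simp only [h1]
  rw [integral_finsetSum]
  · refine Finset.sum_eq_zero fun j _ => ?_
    rw [integral_const_mul,
      T.integral_kernel_mul_integral_exp hn (Nat.succ_le_succ (Nat.zero_le j)) hω hg, mul_zero]
  · intro j _
    refine Integrable.const_mul ?_ _
    have h4 := integrable_kernel_smul hn (F := fun t => T.expGroup ((j + 1 : ℕ) * (t / ω)) f)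
      ((T.continuous_expGroup f).comp (by fun_prop)) ‖f‖ fun t => (T.norm_expGroup _ f).le
    simpa only [inner_smul_right] using h4.const_inner (𝕜 := ℂ) g

end SpectralTransform

-- Dual families from left inverses.

section LeftInverse

variable {H : Type*} [NormedAddCommGroup H] [InnerProductSpace ℂ H] [CompleteSpace H]

theorem hasSum_smul_delta {I : Type*} (x : L2 I) : HasSum (fun i => x i • delta i) x := by
  classical
  refine (lp.hasSum_single (by norm_num) x).congr_fun ?_
  intro i
  rw [delta, ← lp.single_smul, smul_eq_mul, mul_one]

/-- An analysis operator which is bounded below has a dual family. -/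
theorem exists_dual_family {I : Type*} (R : H →L[ℂ] L2 I) {C : NNReal}
    (hR : ∀ x, ‖x‖ ≤ C * ‖R x‖) :
    ∃ ψ : I → H, ∀ x, HasSum (fun i => R x i • ψ i) x := by
  have hanti : AntilipschitzWith C R := R.antilipschitz_of_bound hR
  have hclo : IsClosed (Set.range R) := hanti.isClosed_range R.uniformContinuous
  have hclo' : IsClosed (R.range : Set (L2 I)) := hclo
  have : CompleteSpace R.range := hclo'.completeSpace_coe
  -- The range is closed, so projecting onto it and inverting `R` there is a bounded left inverse;
  -- its values on the `δ_i` form the dual family.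
  let Q : L2 I →L[ℂ] H := (R.equivRange hanti.injective hclo).symm.toContinuousLinearMap ∘L
    R.range.orthogonalProjectionOnto
  have hQ : ∀ x, Q (R x) = x := by
    intro x
    have h1 : R.range.orthogonalProjectionOnto (R x) = R.equivRange hanti.injective hclo x := by
      rw [← Submodule.orthogonalProjectionOnto_mem_subspace_eq_self
        (R.equivRange hanti.injective hclo x)]
      rfl
    simp only [Q, ContinuousLinearMap.comp_apply, h1, ContinuousLinearEquiv.coe_coe,
      ContinuousLinearEquiv.symm_apply_apply]
  refine ⟨fun i => Q (delta i), fun x => ?_⟩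
  have h := Q.hasSum (hasSum_smul_delta (R x))
  simpa only [map_smul, hQ] using h

end LeftInverse

theorem hasSum_norm_sq {I : Type*} (f : L2 I) : HasSum (fun i => ‖f i‖ ^ 2) (‖f‖ ^ 2) := by
  have h := lp.hasSum_norm (by norm_num : 0 < (2 : ENNReal).toReal) f
  simpa using h

theorem sum_norm_sq_le {I : Type*} (f : L2 I) (F : Finset I) : ∑ i ∈ F, ‖f i‖ ^ 2 ≤ ‖f‖ ^ 2 :=
  sum_le_hasSum F (fun _ _ => by positivity) (hasSum_norm_sq f)

-- Local comparison of a function with its samples on `S`.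

section Sampling

variable {V : Type u} {G : SimpleGraph V} [G.LocallyFinite]

/-- Every vertex is assigned itself if it is in `S`, and `K₀` neighbors in `S` otherwise. -/
theorem exists_sampling_nbrs {S : Set V} {K₀ : ℕ} (hS : IsSamplingSet G S K₀) :
    ∃ N : V → Finset V, (∀ v, ∀ u ∈ N v, u ∈ S) ∧
      ∀ v, N v = {v} ∨ (N v ⊆ G.neighborFinset v ∧ (N v).card = K₀) := by
  classical
  have : ∀ v, ∃ N : Finset V, (∀ u ∈ N, u ∈ S) ∧
      (N = {v} ∨ (N ⊆ G.neighborFinset v ∧ N.card = K₀)) := by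
    intro v
    have hv : v ∈ S ∪ vertexBoundary G S := hS.cover ▸ Set.mem_univ v
    rcases hv with hv | hv
    · exact ⟨{v}, by simpa using hv, Or.inl rfl⟩
    · have h := hS.le_ncard v hv
      have e : G.neighborSet v ∩ S = ((G.neighborFinset v).filter (· ∈ S) : Finset V) := by
        ext u; simp
      rw [e, Set.ncard_coe_finset] at h
      obtain ⟨N, hN, hc⟩ := Finset.exists_subset_card_eq h
      exact ⟨N, fun u hu => (Finset.mem_filter.mp (hN hu)).2,
        Or.inr ⟨hN.trans (Finset.filter_subset _ _), hc⟩⟩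
  choose N hN using this
  exact ⟨N, fun v => (hN v).1, fun v => (hN v).2⟩

theorem norm_sq_le_two_mul (a b : ℂ) : ‖a‖ ^ 2 ≤ 2 * ‖a - b‖ ^ 2 + 2 * ‖b‖ ^ 2 := by
  have h : ‖a‖ ≤ ‖a - b‖ + ‖b‖ := by simpa using norm_add_le (a - b) b
  nlinarith [norm_nonneg a, norm_nonneg b, norm_nonneg (a - b), sq_nonneg (‖a - b‖ - ‖b‖)]

theorem sum_nbrs_le {K₀ : ℕ} (hK : 1 ≤ K₀) {N : Finset V} {v : V}
    (hN : N = {v} ∨ (N ⊆ G.neighborFinset v ∧ N.card = K₀)) (g : V → ℂ) :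
    ∑ u ∈ N, ‖g u‖ ^ 2 ≤
      2 * ∑ u ∈ G.neighborFinset v, ‖g u - g v‖ ^ 2 + 2 * K₀ * ‖g v‖ ^ 2 := by
  have hE : 0 ≤ ∑ u ∈ G.neighborFinset v, ‖g u - g v‖ ^ 2 :=
    Finset.sum_nonneg fun _ _ => by positivity
  have hK' : (1 : ℝ) ≤ K₀ := by exact_mod_cast hK
  rcases hN with rfl | ⟨hN, hc⟩
  · rw [Finset.sum_singleton]
    nlinarith [sq_nonneg ‖g v‖]
  · calc ∑ u ∈ N, ‖g u‖ ^ 2 ≤ ∑ u ∈ N, (2 * ‖g u - g v‖ ^ 2 + 2 * ‖g v‖ ^ 2) :=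
          Finset.sum_le_sum fun u _ => norm_sq_le_two_mul _ _
      _ = 2 * ∑ u ∈ N, ‖g u - g v‖ ^ 2 + 2 * K₀ * ‖g v‖ ^ 2 := by
          rw [Finset.sum_add_distrib, ← Finset.mul_sum, Finset.sum_const, hc, nsmul_eq_mul]
          ring
      _ ≤ _ := by
          gcongr

/-- For `v ∉ S`, add `|g v|² ≤ 2|g u - g v|² + 2|g u|²` over the chosen neighbors. The factor `K₀`
on the samples covers the case where `v` samples itself. -/
theorem mul_norm_sq_le_sum_nbrs {K₀ : ℕ} (hK : 1 ≤ K₀) {N : Finset V} {v : V}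
    (hN : N = {v} ∨ (N ⊆ G.neighborFinset v ∧ N.card = K₀)) (g : V → ℂ) :
    K₀ * ‖g v‖ ^ 2 ≤
      2 * ∑ u ∈ G.neighborFinset v, ‖g u - g v‖ ^ 2 + 2 * K₀ * ∑ u ∈ N, ‖g u‖ ^ 2 := by
  have hE : 0 ≤ ∑ u ∈ G.neighborFinset v, ‖g u - g v‖ ^ 2 :=
    Finset.sum_nonneg fun _ _ => by positivity
  have hK' : (1 : ℝ) ≤ K₀ := by exact_mod_cast hK
  rcases hN with rfl | ⟨hN, hc⟩
  · rw [Finset.sum_singleton]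
    nlinarith [sq_nonneg ‖g v‖]
  · have hA : 0 ≤ ∑ u ∈ N, ‖g u‖ ^ 2 := Finset.sum_nonneg fun _ _ => by positivity
    calc K₀ * ‖g v‖ ^ 2 = ∑ u ∈ N, ‖g v‖ ^ 2 := by rw [Finset.sum_const, hc, nsmul_eq_mul]
      _ ≤ ∑ u ∈ N, (2 * ‖g u - g v‖ ^ 2 + 2 * ‖g u‖ ^ 2) := by
          refine Finset.sum_le_sum fun u _ => ?_
          rw [norm_sub_rev]
          exact norm_sq_le_two_mul _ _
      _ = 2 * ∑ u ∈ N, ‖g u - g v‖ ^ 2 + 2 * ∑ u ∈ N, ‖g u‖ ^ 2 := by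
          rw [Finset.sum_add_distrib, ← Finset.mul_sum, ← Finset.mul_sum]
      _ ≤ 2 * ∑ u ∈ G.neighborFinset v, ‖g u - g v‖ ^ 2 + 2 * K₀ * ∑ u ∈ N, ‖g u‖ ^ 2 := by
          gcongr
          linarith

end Sampling

-- Existence of reconstructing families and best approximation.

namespace SpectralTransform

variable {V : Type u} {G : SimpleGraph V} [G.LocallyFinite]
  {X : Type w} [MeasurableSpace X] {μ : Measure X} (T : SpectralTransform G μ)

theorem energy_le_of_mem_PW {ω : ℝ} {g : L2 V} (hg : g ∈ T.PW ω) (F : Finset V) :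
    ∑ v ∈ F, ∑ u ∈ G.neighborFinset v, ‖g u - g v‖ ^ 2 ≤ 2 * ω * ‖g‖ ^ 2 := by
  have h1 := energy_le G g (T.PW_mem_domain hg) F
  have h2 := T.norm_lap_le_of_mem_PW hg (T.PW_mem_domain hg)
  have h3 : (inner ℂ g (lapPow G 1 g (T.PW_mem_domain hg))).re ≤
      ‖g‖ * ‖lapPow G 1 g (T.PW_mem_domain hg)‖ :=
    (Complex.re_le_norm _).trans (norm_inner_le_norm _ _)
  nlinarith [mul_le_mul_of_nonneg_left h2 (norm_nonneg g)]

/-- The sampling theorem: reconstructing families exist. -/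
theorem exists_isReconstructing {S : Set V} {K₀ : ℕ} {ω : ℝ} (hS : IsSamplingSet G S K₀)
    (hω : 0 < ω) (hωK : ω < (K₀ : ℝ) / 4) : ∃ Θ : S → L2 V, T.IsReconstructing ω S Θ := by
  classical
  obtain ⟨N, hNS, hN⟩ := exists_sampling_nbrs hS
  have hK := hS.one_le
  have hsum : ∀ (g : V → ℂ) (F : Finset (Σ v, N v)), ∑ i ∈ F, ‖g i.2‖ ^ 2 ≤
      ∑ v ∈ F.image Sigma.fst, ∑ u ∈ N v, ‖g u‖ ^ 2 := by
    intro g F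
    have h1 : F ⊆ (F.image Sigma.fst).sigma fun v => (Finset.univ : Finset (N v)) := by
      intro i hi
      simp only [Finset.mem_sigma, Finset.mem_univ, and_true]
      exact Finset.mem_image_of_mem _ hi
    refine (Finset.sum_le_sum_of_subset_of_nonneg h1 fun _ _ _ => by positivity).trans_eq ?_
    rw [Finset.sum_sigma]
    exact Finset.sum_congr rfl fun v _ => Finset.sum_coe_sort (N v) fun u => ‖g u‖ ^ 2
  -- A vertex of `S` may be chosen by as many `v` as it has neighbors, and degrees are unbounded;
  -- the energy bound on `PW_ω(L)` still bounds the total of the repeated samples.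
  have hup : ∀ g ∈ T.PW ω, ∀ F : Finset (Σ v, N v), ∑ i ∈ F, ‖(g : V → ℂ) i.2‖ ^ 2 ≤
      (4 * ω + 2 * K₀) * ‖g‖ ^ 2 := by
    intro g hg F
    refine (hsum g F).trans ((Finset.sum_le_sum fun v _ => sum_nbrs_le hK (hN v) g).trans ?_)
    rw [Finset.sum_add_distrib, ← Finset.mul_sum, ← Finset.mul_sum]
    have h1 := T.energy_le_of_mem_PW hg (F.image Sigma.fst)
    have h2 := mul_le_mul_of_nonneg_left (sum_norm_sq_le g (F.image Sigma.fst))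
      (by positivity : (0 : ℝ) ≤ 2 * K₀)
    linarith
  have hmem : ∀ g ∈ T.PW ω, Memℓp (fun i : Σ v, N v => (g : V → ℂ) i.2) 2 := by
    intro g hg
    refine memℓp_gen' (C := (4 * ω + 2 * K₀) * ‖g‖ ^ 2) fun F => ?_
    simpa using hup g hg F
  let R₀ : T.PW ω →ₗ[ℂ] L2 (Σ v, N v) :=
    { toFun := fun g => ⟨fun i => (g : L2 V) i.2, hmem g g.2⟩
      map_add' := fun f g => rfl
      map_smul' := fun c g => rfl }
  let R : T.PW ω →L[ℂ] L2 (Σ v, N v) := R₀.mkContinuous (Real.sqrt (4 * ω + 2 * K₀)) fun g => by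
    have h1 : ‖R₀ g‖ ^ 2 ≤ (4 * ω + 2 * K₀) * ‖g‖ ^ 2 :=
      hasSum_le_of_sum_le (hasSum_norm_sq (R₀ g)) (hup g g.2)
    refine (Real.le_sqrt_of_sq_le h1).trans_eq ?_
    rw [Real.sqrt_mul (by positivity), Real.sqrt_sq (norm_nonneg _)]
  have hc : 0 < (K₀ : ℝ) - 4 * ω := by linarith
  have hlow : ∀ g : T.PW ω, ‖g‖ ^ 2 ≤ 2 * K₀ / (K₀ - 4 * ω) * ‖R g‖ ^ 2 := by
    intro g
    -- The energy enters with factor `2` and is at most `2ω‖g‖²`; the resulting `4ω` is the origin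
    -- of the condition `ω < K₀/4`.
    have h1 : K₀ * ‖g‖ ^ 2 ≤ 4 * ω * ‖g‖ ^ 2 + 2 * K₀ * ‖R g‖ ^ 2 := by
      refine hasSum_le_of_sum_le ((hasSum_norm_sq (g : L2 V)).mul_left (K₀ : ℝ)) fun F => ?_
      refine (Finset.sum_le_sum fun v _ => mul_norm_sq_le_sum_nbrs hK (hN v) (g : L2 V)).trans ?_
      rw [Finset.sum_add_distrib, ← Finset.mul_sum, ← Finset.mul_sum]
      have h2 := T.energy_le_of_mem_PW g.2 F
      have h3 : ∑ v ∈ F, ∑ u ∈ N v, ‖(g : L2 V) u‖ ^ 2 ≤ ‖R g‖ ^ 2 := by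
        refine le_trans (le_of_eq ?_) (sum_norm_sq_le (R g)
          (F.sigma fun v => (Finset.univ : Finset (N v))))
        rw [Finset.sum_sigma]
        exact Finset.sum_congr rfl fun v _ =>
          (Finset.sum_coe_sort (N v) fun u => ‖(g : L2 V) u‖ ^ 2).symm
      have h4 := mul_le_mul_of_nonneg_left h3 (by positivity : (0 : ℝ) ≤ 2 * K₀)
      have h5 : ‖(g : L2 V)‖ = ‖g‖ := rfl
      rw [h5] at h2
      linarith
    rw [div_mul_eq_mul_div, le_div_iff₀ hc]
    linarith
  obtain ⟨ψ, hψ⟩ := exists_dual_family R (C := (Real.sqrt (2 * K₀ / (K₀ - 4 * ω))).toNNReal)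
    fun g => by
      rw [Real.coe_toNNReal _ (Real.sqrt_nonneg _)]
      have := Real.le_sqrt_of_sq_le (hlow g)
      rwa [Real.sqrt_mul (by positivity), Real.sqrt_sq (norm_nonneg _)] at this
  let pt : (Σ v, N v) → S := fun i => ⟨i.2, hNS i.1 i.2 i.2.2⟩
  -- A vertex `u` can only be chosen by itself or by its finitely many neighbors. Hence repeated
  -- samples can be regrouped, with `Θ_u` the sum of the dual vectors over the fiber.
  have hfib : ∀ u : S, Finite {i // pt i = u} := by
    intro u
    let F : Finset V := {(u : V)} ∪ G.neighborFinset u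
    have hF : Set.Finite {i : Σ v, N v | pt i = u} := by
      refine ((F.sigma fun v => (Finset.univ : Finset (N v))).finite_toSet).subset ?_
      rintro ⟨v, w⟩ hw
      have hwu : (w : V) = u := congrArg Subtype.val hw
      simp only [Finset.coe_sigma, Set.mem_sigma_iff, Finset.mem_coe, Finset.mem_univ, and_true, F,
        Finset.mem_union, Finset.mem_singleton, SimpleGraph.mem_neighborFinset]
      rcases hN v with h | ⟨h, _⟩
      · have hv : ∀ x ∈ N v, x = v := by simp [h]
        exact Or.inl ((hv w w.2).symm.trans hwu)
      · have := h w.2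
        rw [SimpleGraph.mem_neighborFinset, hwu] at this
        exact Or.inr this.symm
    exact hF.to_subtype
  have hfib' : ∀ u : S, Fintype {i // pt i = u} := fun u => Fintype.ofFinite _
  refine ⟨fun u => ∑ i : {i // pt i = u}, (ψ i : L2 V), fun u => ?_, fun f hf => ?_⟩
  · exact Submodule.sum_mem _ fun i _ => (ψ i).2
  · have h1 := (T.PW ω).subtypeL.hasSum (hψ ⟨f, hf⟩)
    have h2 := (Equiv.sigmaFiberEquiv pt).hasSum_iff.mpr h1
    refine h2.sigma fun u => ?_
    have h3 := hasSum_fintype fun i : {i // pt i = u} => (f : V → ℂ) u • (ψ i : L2 V)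
    rw [← Finset.smul_sum] at h3
    refine h3.congr_fun ?_
    rintro ⟨i, rfl⟩
    rfl

/-- The approximation by any reconstructing family reproduces the Paley-Wiener space. -/
theorem norm_sub_starProjection_le {ω : ℝ} (f : L2 V) {g : L2 V} (hg : g ∈ T.PW ω) :
    ‖f - (T.PW ω).starProjection f‖ ≤ ‖f - g‖ := by
  rw [Submodule.starProjection_minimal]
  exact ciInf_le ⟨0, by rintro _ ⟨x, rfl⟩; exact norm_nonneg _⟩ (⟨g, hg⟩ : T.PW ω)

end SpectralTransform

end GraphSampling

end

-- The main theorem.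

open GraphSampling
theorem corollary4p4 :
    ∃ C : ℕ → ℕ → ℕ → ℝ, (∀ n k m, 0 < C n k m) ∧
      ∀ (V : Type u) (G : SimpleGraph V) [G.LocallyFinite], G.Connected →
        -- the Laplacian has a spectral Fourier transform
        (∃ (X : Type u) (_ : MeasurableSpace X) (μ : Measure X),
          Nonempty (SpectralTransform G μ)) ∧
        -- and, whichever one is used to define `PW_ω(L)` and `e^{itL}`:
        ∀ (X : Type w) [MeasurableSpace X] (μ : Measure X)
          (T : SpectralTransform G μ) (S : Set V) (K₀ : ℕ) (ω : ℝ),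
          IsSamplingSet G S K₀ → 0 < ω → ω < (K₀ : ℝ) / 4 →
          (∃ Θ : S → L2 V, T.IsReconstructing ω S Θ) ∧
          ∀ Θ : S → L2 V, T.IsReconstructing ω S Θ →
            ∀ n m : ℕ, Even n → m + 2 ≤ n → ∀ f : L2 V,
              Integrable (T.filterIntegrand n m ω f) ∧
              T.filterOp n m ω f ∈ T.PW ω ∧
              Summable (fun u : S => ((T.PW ω).starProjection f : V → ℂ) u • Θ u) ∧
              Summable (fun u : S => (T.filterOp n m ω f : V → ℂ) u • Θ u) ∧
              ‖f - ∑' u : S, ((T.PW ω).starProjection f : V → ℂ) u • Θ u‖ ≤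
                ‖f - ∑' u : S, (T.filterOp n m ω f : V → ℂ) u • Θ u‖ ∧
              ∀ k ≤ m, ∀ hf : f ∈ lapPowDomain G k,
                ‖f - ∑' u : S, (T.filterOp n m ω f : V → ℂ) u • Θ u‖ ≤
                  C n k m / ω ^ k * T.modulus (m - k) (lapPow G k f hf) (1 / ω) := by
  -- The summand `1` makes the constant positive for every `n`, including those for which the
  -- integral is not known to converge.
  refine ⟨fun n _ m => 1 + ∫ t, |kernel n t| * (1 + |t|) ^ m, fun n _ m => ?_,
    fun V G _ hG => ⟨exists_spectralTransform G hG, ?_⟩⟩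
  · have : 0 ≤ ∫ t, |kernel n t| * (1 + |t|) ^ m := integral_nonneg fun t => by positivity
    linarith
  intro X _ μ T S K₀ ω hS hω hωK
  refine ⟨T.exists_isReconstructing hS hω hωK, fun Θ hΘ n m he hn f => ?_⟩
  have hn2 : 2 ≤ n := by omega
  have hP := T.filterOp_mem_PW hn2 m hω f
  have h1 := hΘ.hasSum _ hP
  have h2 := hΘ.hasSum _ (Submodule.starProjection_apply_mem (T.PW ω) f)
  refine ⟨T.integrable_filterIntegrand hn2 m ω f, hP, h2.summable, h1.summable, ?_, ?_⟩
  · rw [h1.tsum_eq, h2.tsum_eq]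
    exact T.norm_sub_starProjection_le f hP
  · intro k hk hf
    rw [h1.tsum_eq]
    refine (T.norm_sub_filterOp_le hn he hk hω f hf).trans ?_
    have hΩ : 0 ≤ T.modulus (m - k) (lapPow G k f hf) (1 / ω) :=
      (norm_nonneg _).trans (T.norm_diff_le_modulus (τ := 0) (m - k) (lapPow G k f hf)
        (by simpa using hω.le))
    refine mul_le_mul_of_nonneg_right ?_ hΩ
    gcongr
    linarith
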